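/- Let $n\ge 1$. An $n$-diagram is a perfect matching of $2n$ vertices, $1,\dots,n$ on a top line and $1',\dots,n'$ on a parallel bottom line, that can be drawn between the lines without crossings. For a commutative ring $\Bbbk$ and $\delta\in\Bbbk$ let $D_n(\delta)$ be the free $\Bbbk$-module on the $n$-diagrams, with the multiplication extending bilinearly the rule $d_1d_2=\delta^L d_3$: stack $d_1$ on top of $d_2$, identifying the middle vertices, let $L$ be the number of closed loops so obtained and $d_3$ the $n$-diagram that remains when the middle data are removed. This is an associative unital $\Bbbk$-algebra, whose unit is the diagram with edges $\{j,j'\}$ ($1\le j\le n$). For $1\le i\le n-1$ let $\hat e_i$ be the diagram with edges $\{i,i+1\}$, $\{i',(i+1)'\}$ and $\{j,j'\}$ for $j\ne i,i+1$. Let $TL_n(\delta)$ be the unital associative $\Bbbk$-algebra with generators $e_1,\dots,e_{n-1}$ and relations $e_i^2=\delta e_i$; $e_ie_je_i=e_i$ if $|i-j|=1$; $e_ie_j=e_je_i$ if $|i-j|>1$. (a) For every $\Bbbk$ and $\delta$, every $n$-diagram is equal in $D_n(\delta)$ to a (possibly empty) product of the diagrams $\hat e_i$, $1\le i\le n-1$.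 (b) If $\Bbbk=\mathbb{Z}[x]$ and $\delta=x$, the algebra morphism $\sigma:TL_n(x)\to D_n(x)$ with $\sigma(e_i)=\hat e_i$ for all $i$ is an isomorphism of $\mathbb{Z}[x]$-algebras. -/

import Mathlib

namespace TemperleyLieb

/-! ### The Temperley-Lieb algebra -/

/-- The defining relations of the Temperley-Lieb algebra. The generators `e_1, …, e_{n-1}` are
indexed by `Fin (n - 1)`, so that `i : Fin (n - 1)` stands for `e_{i+1}`. -/
inductive Rel {k : Type*} [CommRing k] (n : ℕ) (δ : k) :
    FreeAlgebra k (Fin (n - 1)) → FreeAlgebra k (Fin (n - 1)) → Prop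
  | sq (i : Fin (n - 1)) :
      Rel n δ (FreeAlgebra.ι k i * FreeAlgebra.ι k i) (δ • FreeAlgebra.ι k i)
  | braid (i j : Fin (n - 1)) (h : |((i : ℕ) : ℤ) - ((j : ℕ) : ℤ)| = 1) :
      Rel n δ (FreeAlgebra.ι k i * FreeAlgebra.ι k j * FreeAlgebra.ι k i) (FreeAlgebra.ι k i)
  | comm (i j : Fin (n - 1)) (h : 1 < |((i : ℕ) : ℤ) - ((j : ℕ) : ℤ)|) :
      Rel n δ (FreeAlgebra.ι k i * FreeAlgebra.ι k j) (FreeAlgebra.ι k j * FreeAlgebra.ι k i)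

/-- The Temperley-Lieb algebra `TL_n(δ)`: the unital associative `k`-algebra given by generators
and relations. -/
abbrev TL {k : Type*} [CommRing k] (n : ℕ) (δ : k) : Type _ := RingQuot (Rel n δ)

/-- The generators `e_i` of `TL_n(δ)`. -/
def TL.e {k : Type*} [CommRing k] {n : ℕ} (δ : k) (i : Fin (n - 1)) : TL n δ :=
  RingQuot.mkAlgHom k (Rel n δ) (FreeAlgebra.ι k i)

/-! ### Planar diagrams -/

/-- The `2n` vertices: `Sum.inl i` is the `i`-th vertex on the top line, `Sum.inr i` is the `i`-th
vertex on the bottom line (both numbered from left to right). -/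
abbrev Vertex (n : ℕ) : Type := Fin n ⊕ Fin n

/-- The position of a vertex when one walks around the boundary of the strip: along the top line
from left to right, then along the bottom line from right to left. -/
def boundaryPos {n : ℕ} : Vertex n → ℕ
  | Sum.inl i => (i : ℕ)
  | Sum.inr i => 2 * n - 1 - (i : ℕ)

/-- An `n`-diagram: a graph on the `2n` vertices in which every vertex is the endpoint of exactly
one edge and which can be drawn without crossings between the two lines, that is, no two edges
have interlacing endpoints on the boundary. -/
@[ext]
structure Diagram (n : ℕ) where
  graph : SimpleGraph (Vertex n)
  existsUnique_adj : ∀ v, ∃! w, graph.Adj v w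
  noncrossing : ∀ a b c d, graph.Adj a b → graph.Adj c d →
    ¬ (boundaryPos a < boundaryPos c ∧ boundaryPos c < boundaryPos b ∧
      boundaryPos b < boundaryPos d)

namespace Diagram

/-- The identity diagram, with edges `{j, j'}`. -/
def id (n : ℕ) : Diagram n where
  graph := SimpleGraph.fromEdgeSet {x | ∃ j : Fin n, x = s(Sum.inl j, Sum.inr j)}
  existsUnique_adj := by
    rintro (v | v)
    · refine ⟨Sum.inr v, ?_, ?_⟩
      · simp
      · rintro (w | w) <;> simp
    · refine ⟨Sum.inl v, ?_, ?_⟩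
      · simp
      · rintro (w | w) <;> simp
  noncrossing := by
    rintro (a | a) (b | b) (c | c) (d | d) <;> simp [boundaryPos] <;> intros <;> subst_vars <;> omega

/-- The diagram `ê_i`, with edges `{i, i+1}`, `{i', (i+1)'}` and `{j, j'}` for `j ≠ i, i+1`. -/
def hatE {n : ℕ} (i : Fin (n - 1)) : Diagram n where
  graph := SimpleGraph.fromEdgeSet
    ({s(Sum.inl ⟨i, by omega⟩, Sum.inl ⟨i + 1, by omega⟩),
      s(Sum.inr ⟨i, by omega⟩, Sum.inr ⟨i + 1, by omega⟩)} ∪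
      {x | ∃ j : Fin n, (j : ℕ) ≠ i ∧ (j : ℕ) ≠ i + 1 ∧ x = s(Sum.inl j, Sum.inr j)})
  existsUnique_adj := by
    rintro (v | v)
    · by_cases h1 : (v : ℕ) = i
      · refine ⟨Sum.inl ⟨i + 1, by omega⟩, ?_, ?_⟩
        · simp [Fin.ext_iff, h1]
        · rintro (w | w) <;> simp [Fin.ext_iff] <;> omega
      · by_cases h2 : (v : ℕ) = i + 1
        · refine ⟨Sum.inl ⟨i, by omega⟩, ?_, ?_⟩
          · simp [Fin.ext_iff, h2]
          · rintro (w | w) <;> simp [Fin.ext_iff] <;> omega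
        · refine ⟨Sum.inr v, ?_, ?_⟩
          · simp [h1, h2]
          · rintro (w | w) <;> simp [Fin.ext_iff] <;> omega
    · by_cases h1 : (v : ℕ) = i
      · refine ⟨Sum.inr ⟨i + 1, by omega⟩, ?_, ?_⟩
        · simp [Fin.ext_iff, h1]
        · rintro (w | w) <;> simp [Fin.ext_iff] <;> omega
      · by_cases h2 : (v : ℕ) = i + 1
        · refine ⟨Sum.inr ⟨i, by omega⟩, ?_, ?_⟩
          · simp [Fin.ext_iff, h2]
          · rintro (w | w) <;> simp [Fin.ext_iff] <;> omega
        · refine ⟨Sum.inl v, ?_, ?_⟩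
          · simp [h1, h2]
          · rintro (w | w) <;> simp [Fin.ext_iff] <;> omega
  noncrossing := by
    rintro (a | a) (b | b) (c | c) (d | d) <;>
      simp [boundaryPos, Fin.ext_iff] <;> omega

/-! ### Stacking two diagrams -/

/-- The vertices of the stack of two diagrams: the top line, the middle line (on which the bottom
line of the upper diagram and the top line of the lower diagram are identified), and the bottom
line. -/
abbrev Stack (n : ℕ) : Type := Fin n ⊕ (Fin n ⊕ Fin n)

/-- Placement of the upper diagram in the stack. -/
def upper (n : ℕ) : Vertex n ↪ Stack n where
  toFun := Sum.elim Sum.inl (fun i => Sum.inr (Sum.inl i))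
  inj' := by rintro (a | a) (b | b) <;> simp

/-- Placement of the lower diagram in the stack. -/
def lower (n : ℕ) : Vertex n ↪ Stack n where
  toFun := Sum.inr
  inj' := Sum.inr_injective

/-- The vertices of the stack that lie on the top or the bottom line. -/
def outer (n : ℕ) : Vertex n ↪ Stack n where
  toFun := Sum.elim Sum.inl (fun i => Sum.inr (Sum.inr i))
  inj' := by rintro (a | a) (b | b) <;> simp

@[simp] theorem upper_inl {n : ℕ} (i : Fin n) : upper n (Sum.inl i) = Sum.inl i := rfl
@[simp] theorem upper_inr {n : ℕ} (i : Fin n) : upper n (Sum.inr i) = Sum.inr (Sum.inl i) := rfl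
@[simp] theorem lower_apply {n : ℕ} (v : Vertex n) : lower n v = Sum.inr v := rfl
@[simp] theorem outer_inl {n : ℕ} (i : Fin n) : outer n (Sum.inl i) = Sum.inl i := rfl
@[simp] theorem outer_inr {n : ℕ} (i : Fin n) : outer n (Sum.inr i) = Sum.inr (Sum.inr i) := rfl

/-- The graph obtained by stacking `d₁` on top of `d₂`. -/
def stack {n : ℕ} (d₁ d₂ : Diagram n) : SimpleGraph (Stack n) :=
  d₁.graph.map (upper n) ⊔ d₂.graph.map (lower n)

/-- The number `L` of loops in the middle of the stack: the number of connected components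
without a vertex on the top or the bottom line. -/
noncomputable def loops {n : ℕ} (d₁ d₂ : Diagram n) : ℕ :=
  Nat.card {C : (stack d₁ d₂).ConnectedComponent //
    ∀ v, (stack d₁ d₂).connectedComponentMk (outer n v) ≠ C}

/-- The graph that remains when the middle data of the stack are removed: two outer vertices are
joined by an edge if a path of the stack connects them. -/
def compGraph {n : ℕ} (d₁ d₂ : Diagram n) : SimpleGraph (Vertex n) where
  Adj v w := v ≠ w ∧ (stack d₁ d₂).Reachable (outer n v) (outer n w)
  symm := ⟨fun _ _ h => ⟨h.1.symm, h.2.symm⟩⟩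
  loopless := ⟨fun _ h => h.1 rfl⟩

/-- The other endpoint of the edge at a vertex. -/
noncomputable def partner {n : ℕ} (d : Diagram n) (v : Vertex n) : Vertex n :=
  (d.existsUnique_adj v).choose

theorem adj_iff {n : ℕ} (d : Diagram n) (v w : Vertex n) : d.graph.Adj v w ↔ w = d.partner v :=
  ⟨fun h => (d.existsUnique_adj v).choose_spec.2 w h,
    fun h => h ▸ (d.existsUnique_adj v).choose_spec.1⟩

theorem adj_partner {n : ℕ} (d : Diagram n) (v : Vertex n) : d.graph.Adj v (d.partner v) :=
  (d.adj_iff v _).2 rfl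

theorem partner_partner {n : ℕ} (d : Diagram n) (v : Vertex n) :
    d.partner (d.partner v) = v :=
  ((d.adj_iff _ _).1 (d.adj_partner v).symm).symm

theorem partner_ne {n : ℕ} (d : Diagram n) (v : Vertex n) : d.partner v ≠ v :=
  (d.adj_partner v).ne'

theorem boundaryPos_injective {n : ℕ} : Function.Injective (boundaryPos (n := n)) := by
  rintro (a | a) (b | b) <;> simp [boundaryPos, Fin.ext_iff] <;> omega

/-! Each component of the stack has at most two outer vertices. -/

theorem cyclic_aux {X : Type*} (α β : Equiv.Perm X) (hα : ∀ x, α (α x) = x)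
    (hβ : ∀ x, β (β x) = x) (v : X) (hv : β v = v) (u : X)
    (h : Relation.ReflTransGen (fun x y => y = α x ∨ y = β x) v u) :
    ∃ k : ℤ, ((β * α) ^ k) v = u ∧ (α u = u → ((β * α) ^ (2 * k + 1)) v = v) ∧
      (β u = u → ((β * α) ^ (2 * k)) v = v) := by
  have hαi : α⁻¹ = α := by ext x; rw [Equiv.Perm.inv_eq_iff_eq, hα]
  have hβi : β⁻¹ = β := by ext x; rw [Equiv.Perm.inv_eq_iff_eq, hβ]
  have hinv : (β * α)⁻¹ = α * β := by rw [mul_inv_rev, hαi, hβi]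
  have cα : ∀ k : ℤ, α * (β * α) ^ k * α⁻¹ = (β * α) ^ (-k) := by
    intro k
    rw [← conj_zpow, zpow_neg, ← inv_zpow, hinv]
    congr 1; rw [mul_assoc, mul_assoc, mul_inv_cancel, mul_one]
  have cβ : ∀ k : ℤ, β * (β * α) ^ k * β⁻¹ = (β * α) ^ (-k) := by
    intro k
    rw [← conj_zpow, zpow_neg, ← inv_zpow, hinv, hβi]
    congr 1; ext x; simp [hβ]
  have aα : ∀ k : ℤ, α (((β * α) ^ k) v) = ((β * α) ^ (-k - 1)) v := by
    intro k
    have h1 : α v = ((β * α) ^ (-1 : ℤ)) v := by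
      rw [zpow_neg_one, hinv, Equiv.Perm.mul_apply, hv]
    calc α (((β * α) ^ k) v) = (α * (β * α) ^ k * α⁻¹) (α v) := by simp
      _ = ((β * α) ^ (-k - 1)) v := by
        rw [cα, h1, ← Equiv.Perm.mul_apply, ← zpow_add, sub_eq_add_neg]
  have aβ : ∀ k : ℤ, β (((β * α) ^ k) v) = ((β * α) ^ (-k)) v := by
    intro k
    calc β (((β * α) ^ k) v) = (β * (β * α) ^ k * β⁻¹) (β v) := by simp
      _ = ((β * α) ^ (-k)) v := by rw [cβ, hv]
  have key : ∃ k : ℤ, ((β * α) ^ k) v = u := by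
    induction h with
    | refl => exact ⟨0, by simp⟩
    | tail _ hs ih =>
      obtain ⟨k, rfl⟩ := ih
      rcases hs with rfl | rfl
      · exact ⟨-k - 1, (aα k).symm⟩
      · exact ⟨-k, (aβ k).symm⟩
  obtain ⟨k, rfl⟩ := key
  refine ⟨k, rfl, fun h => ?_, fun h => ?_⟩
  · rw [aα] at h
    have := congrArg ((β * α) ^ (k + 1)) h
    rw [← Equiv.Perm.mul_apply, ← Equiv.Perm.mul_apply, ← zpow_add, ← zpow_add] at this
    rw [show 2 * k + 1 = k + 1 + k by ring, ← this, show k + 1 + (-k - 1) = 0 by ring]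
    simp
  · rw [aβ] at h
    have := congrArg ((β * α) ^ k) h
    rw [← Equiv.Perm.mul_apply, ← Equiv.Perm.mul_apply, ← zpow_add, ← zpow_add] at this
    rw [show 2 * k = k + k by ring, ← this, show k + -k = 0 by ring]
    simp

theorem at_most_two {X : Type*} (α β : Equiv.Perm X) (hα : ∀ x, α (α x) = x)
    (hβ : ∀ x, β (β x) = x) (v u w : X) (hv : β v = v)
    (hu : α u = u ∨ β u = u) (hw : α w = w ∨ β w = w)
    (hvu : Relation.ReflTransGen (fun x y => y = α x ∨ y = β x) v u)
    (hvw : Relation.ReflTransGen (fun x y => y = α x ∨ y = β x) v w)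
    (hu' : u ≠ v) (hw' : w ≠ v) : u = w := by
  obtain ⟨k, rfl, k1, k2⟩ := cyclic_aux α β hα hβ v hv u hvu
  obtain ⟨l, rfl, l1, l2⟩ := cyclic_aux α β hα hβ v hv w hvw
  set π := β * α
  let S : AddSubgroup ℤ :=
    { carrier := {k | (π ^ k) v = v}
      zero_mem' := by simp
      add_mem' := by
        intro a b ha hb
        simp only [Set.mem_ofPred_eq] at *
        rw [zpow_add, Equiv.Perm.mul_apply, hb, ha]
      neg_mem' := by
        intro a ha
        simp only [Set.mem_ofPred_eq] at *
        rw [zpow_neg, Equiv.Perm.inv_eq_iff_eq, ha] }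
  have hS : ∀ a, a ∈ S ↔ (π ^ a) v = v := fun a => Iff.rfl
  obtain ⟨m, hm⟩ := Int.subgroup_cyclic S
  have hmem : ∀ a, (π ^ a) v = v ↔ m ∣ a := by
    intro a
    rw [← hS, hm, AddSubgroup.mem_closure_singleton]
    constructor
    · rintro ⟨c, rfl⟩; exact ⟨c, by simp [mul_comm]⟩
    · rintro ⟨c, rfl⟩; exact ⟨c, by simp [mul_comm]⟩
  have hk : ¬ m ∣ k := fun h => hu' ((hmem k).2 h)
  have hl : ¬ m ∣ l := fun h => hw' ((hmem l).2 h)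
  suffices h : m ∣ k - l by
    have := (hmem _).2 h
    have h2 := congrArg (π ^ l) this
    rw [← Equiv.Perm.mul_apply, ← zpow_add] at h2
    rw [← h2]; congr 2; ring
  have even_of : ∀ a, ¬ m ∣ a → m ∣ 2 * a → ∃ c, 2 * a = m * (2 * c + 1) := by
    rintro a ha ⟨c, hc⟩
    rcases Int.even_or_odd' c with ⟨e, rfl | rfl⟩
    · exact absurd ⟨e, by linarith⟩ ha
    · exact ⟨e, hc⟩
  have mixed : ∀ a b, ¬ m ∣ a → m ∣ 2 * a → ¬ m ∣ 2 * b + 1 := by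
    rintro a b ha h ⟨c, hc⟩
    obtain ⟨e, he⟩ := even_of a ha h
    have hme : Even m := by
      have : Even (m * (2 * e + 1)) := ⟨a, by linarith⟩
      rcases Int.even_mul.1 this with h | h
      · exact h
      · exact absurd h (by simp)
    have : Even (2 * b + 1) := hc ▸ hme.mul_right c
    exact absurd this (by simp)
  rcases hu with hu | hu <;> rcases hw with hw | hw
  · have a1 := (hmem _).1 (k1 hu)
    have a2 := (hmem _).1 (l1 hw)
    have hodd : IsCoprime m 2 := by
      obtain ⟨c, hc⟩ := a1
      exact ⟨c, -k, by linarith⟩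
    refine hodd.dvd_of_dvd_mul_left (?_ : m ∣ 2 * (k - l))
    have := dvd_sub a1 a2
    rwa [show 2 * k + 1 - (2 * l + 1) = 2 * (k - l) by ring] at this
  · exact absurd ((hmem _).1 (k1 hu)) (mixed l k hl ((hmem _).1 (l2 hw)))
  · exact absurd ((hmem _).1 (l1 hw)) (mixed k l hk ((hmem _).1 (k2 hu)))
  · obtain ⟨a, ha⟩ := even_of k hk ((hmem _).1 (k2 hu))
    obtain ⟨b, hb⟩ := even_of l hl ((hmem _).1 (l2 hw))
    exact ⟨a - b, by linarith⟩

/-- The involution of the stack that exchanges the endpoints of the edges of `d₁`. -/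
noncomputable def upperPerm {n : ℕ} (d : Diagram n) : Equiv.Perm (Stack n) :=
  Function.Involutive.toPerm
    (fun x => match x with
      | Sum.inl i => upper n (d.partner (Sum.inl i))
      | Sum.inr (Sum.inl i) => upper n (d.partner (Sum.inr i))
      | Sum.inr (Sum.inr i) => Sum.inr (Sum.inr i))
    (by
      have key : ∀ v, (match upper n v with
          | Sum.inl i => upper n (d.partner (Sum.inl i))
          | Sum.inr (Sum.inl i) => upper n (d.partner (Sum.inr i))
          | Sum.inr (Sum.inr i) => Sum.inr (Sum.inr i)) = upper n (d.partner v) := by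
        rintro (v | v) <;> rfl
      rintro (i | i | i)
      · exact (key _).trans (by rw [partner_partner]; rfl)
      · exact (key _).trans (by rw [partner_partner]; rfl)
      · rfl)

/-- The involution of the stack that exchanges the endpoints of the edges of `d₂`. -/
noncomputable def lowerPerm {n : ℕ} (d : Diagram n) : Equiv.Perm (Stack n) :=
  Function.Involutive.toPerm (Sum.map _root_.id d.partner)
    (by rintro (i | i) <;> simp [partner_partner])

theorem upperPerm_upper {n : ℕ} (d : Diagram n) (v : Vertex n) :
    upperPerm d (upper n v) = upper n (d.partner v) := by
  rcases v with v | v <;> rfl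

theorem stack_adj {n : ℕ} {d₁ d₂ : Diagram n} {x y : Stack n} (h : (stack d₁ d₂).Adj x y) :
    y = upperPerm d₁ x ∨ y = lowerPerm d₂ x := by
  rw [stack, SimpleGraph.sup_adj, SimpleGraph.map_adj, SimpleGraph.map_adj] at h
  rcases h with ⟨u, v, h, rfl, rfl⟩ | ⟨u, v, h, rfl, rfl⟩
  · left; rw [upperPerm_upper, (adj_iff _ _ _).1 h]
  · right; rw [(adj_iff _ _ _).1 h]; rfl

theorem stack_reach {n : ℕ} {d₁ d₂ : Diagram n} {x y : Stack n}
    (h : (stack d₁ d₂).Reachable x y) :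
    Relation.ReflTransGen (fun a b => b = upperPerm d₁ a ∨ b = lowerPerm d₂ a) x y := by
  rw [SimpleGraph.reachable_iff_reflTransGen] at h
  exact Relation.ReflTransGen.mono (fun _ _ => stack_adj) _ _ h

theorem upperPerm_upperPerm {n : ℕ} (d : Diagram n) (x : Stack n) :
    upperPerm d (upperPerm d x) = x := by
  rcases x with i | i | i
  · exact (upperPerm_upper d _).trans (by rw [partner_partner]; rfl)
  · exact (upperPerm_upper d _).trans (by rw [partner_partner]; rfl)
  · rfl

theorem lowerPerm_lowerPerm {n : ℕ} (d : Diagram n) (x : Stack n) :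
    lowerPerm d (lowerPerm d x) = x := by
  rcases x with i | i
  · rfl
  · exact congrArg Sum.inr (d.partner_partner i)

theorem compGraph_unique {n : ℕ} {d₁ d₂ : Diagram n} {u v w : Vertex n}
    (h₁ : (compGraph d₁ d₂).Adj u v) (h₂ : (compGraph d₁ d₂).Adj u w) : v = w := by
  have hfix : ∀ v : Vertex n, upperPerm d₁ (outer n v) = outer n v ∨
      lowerPerm d₂ (outer n v) = outer n v := by
    rintro (v | v)
    · right; rfl
    · left; rfl
  have n1 : outer n v ≠ outer n u := fun h => h₁.1 ((outer n).injective h).symm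
  have n2 : outer n w ≠ outer n u := fun h => h₂.1 ((outer n).injective h).symm
  apply (outer n).injective
  rcases u with u | u
  · exact at_most_two _ _ (upperPerm_upperPerm d₁) (lowerPerm_lowerPerm d₂) _ _ _ rfl
      (hfix v) (hfix w) (stack_reach h₁.2) (stack_reach h₂.2) n1 n2
  · exact at_most_two _ _ (lowerPerm_lowerPerm d₂) (upperPerm_upperPerm d₁) _ _ _ rfl
      (hfix v).symm (hfix w).symm (Relation.ReflTransGen.mono (fun _ _ => Or.symm) _ _ (stack_reach h₁.2))
      (Relation.ReflTransGen.mono (fun _ _ => Or.symm) _ _ (stack_reach h₂.2)) n1 n2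

/-! Parity: each component has an even number of outer vertices, and planarity is preserved. -/

theorem sum_partner {n : ℕ} (d : Diagram n) (f : Vertex n → ZMod 2)
    (hf : ∀ v, f (d.partner v) = f v) : ∑ v, f v = 0 :=
  Finset.sum_involution (fun v _ => d.partner v)
    (fun v _ => by rw [hf]; exact CharTwo.add_self_eq_zero _)
    (fun v _ _ => d.partner_ne v) (fun _ _ => Finset.mem_univ _) (fun v _ => d.partner_partner v)

/-- The indicator of `s` preceding `t` on the boundary. -/
def before {n : ℕ} (s t : Vertex n) : ZMod 2 := if boundaryPos s < boundaryPos t then 1 else 0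

theorem before_four {n : ℕ} (d : Diagram n) (s t : Vertex n) (h1 : s ≠ t)
    (h2 : s ≠ d.partner t) :
    before s t + before (d.partner s) t + (before s (d.partner t) +
      before (d.partner s) (d.partner t)) = 0 := by
  have a1 := d.adj_partner s
  have a2 := d.adj_partner t
  have n1 := d.noncrossing _ _ _ _ a1 a2
  have n2 := d.noncrossing _ _ _ _ a1 a2.symm
  have n3 := d.noncrossing _ _ _ _ a1.symm a2
  have n4 := d.noncrossing _ _ _ _ a1.symm a2.symm
  have m1 := d.noncrossing _ _ _ _ a2 a1
  have m2 := d.noncrossing _ _ _ _ a2 a1.symm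
  have m3 := d.noncrossing _ _ _ _ a2.symm a1
  have m4 := d.noncrossing _ _ _ _ a2.symm a1.symm
  have e1 : boundaryPos s ≠ boundaryPos t := fun h => h1 (boundaryPos_injective h)
  have e2 : boundaryPos s ≠ boundaryPos (d.partner t) := fun h => h2 (boundaryPos_injective h)
  have e3 : boundaryPos (d.partner s) ≠ boundaryPos t := fun h => h2 (by
    rw [← boundaryPos_injective h, partner_partner])
  have e4 : boundaryPos (d.partner s) ≠ boundaryPos (d.partner t) := fun h => h1 (by
    rw [← d.partner_partner s, boundaryPos_injective h, partner_partner])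
  unfold before
  generalize boundaryPos s = a at *
  generalize boundaryPos t = b at *
  generalize boundaryPos (d.partner s) = a' at *
  generalize boundaryPos (d.partner t) = b' at *
  split_ifs <;> first | decide | (exfalso; omega)

theorem sum_before {n : ℕ} (d : Diagram n) (f g : Vertex n → ZMod 2)
    (hf : ∀ v, f (d.partner v) = f v) (hg : ∀ v, g (d.partner v) = g v)
    (hfg : ∀ v, f v * g v = 0) : ∑ s, ∑ t, f s * g t * before s t = 0 := by
  refine Finset.sum_involution (fun v _ => d.partner v) (fun s _ => ?_)
    (fun v _ _ => d.partner_ne v) (fun _ _ => Finset.mem_univ _) (fun v _ => d.partner_partner v)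
  rw [← Finset.sum_add_distrib]
  refine Finset.sum_involution (fun v _ => d.partner v) (fun t _ => ?_)
    (fun v _ _ => d.partner_ne v) (fun _ _ => Finset.mem_univ _) (fun v _ => d.partner_partner v)
  rw [hf, hg]
  by_cases h1 : s = t
  · subst h1; simp [hfg]
  by_cases h2 : s = d.partner t
  · have : f s * g t = 0 := by rw [← hg, ← h2, hfg]
    simp [this]
  have := before_four d s t h1 h2
  linear_combination (f s * g t) * this

/-- The key parity computation: `A`, `B` are functions on the stack that are constant along all
edges and have disjoint supports. -/
theorem sum_outer {n : ℕ} (d₁ d₂ : Diagram n) (A B : Stack n → ZMod 2)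
    (hA₁ : ∀ v, A (upper n (d₁.partner v)) = A (upper n v))
    (hA₂ : ∀ v, A (lower n (d₂.partner v)) = A (lower n v))
    (hB₁ : ∀ v, B (upper n (d₁.partner v)) = B (upper n v))
    (hB₂ : ∀ v, B (lower n (d₂.partner v)) = B (lower n v))
    (hAB : ∀ x, A x * B x = 0) :
    ∑ v, A (outer n v) = 0 ∧
    ∑ s, ∑ t, A (outer n s) * B (outer n t) * before s t = 0 := by
  have pA1 := sum_partner d₁ (fun v => A (upper n v)) hA₁
  have pA2 := sum_partner d₂ (fun v => A (lower n v)) hA₂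
  have pB1 := sum_partner d₁ (fun v => B (upper n v)) hB₁
  have pB2 := sum_partner d₂ (fun v => B (lower n v)) hB₂
  have c1 := sum_before d₁ (fun v => A (upper n v)) (fun v => B (upper n v)) hA₁ hB₁ (fun v => hAB _)
  have c2 := sum_before d₂ (fun v => A (lower n v)) (fun v => B (lower n v)) hA₂ hB₂ (fun v => hAB _)
  have b1 : ∀ i j : Fin n, before (n := n) (Sum.inl i) (Sum.inr j) = 1 := by
    exact fun i j => if_pos (by simp only [boundaryPos]; omega)
  have b2 : ∀ i j : Fin n, before (n := n) (Sum.inr i) (Sum.inl j) = 0 := by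
    exact fun i j => if_neg (by simp only [boundaryPos]; omega)
  have b3 : ∀ i j : Fin n, i ≠ j →
      before (n := n) (Sum.inr i) (Sum.inr j) = before (n := n) (Sum.inl i) (Sum.inl j) + 1 := by
    intro i j h
    rw [Ne, Fin.ext_iff] at h
    unfold before
    rcases Nat.lt_or_gt_of_ne h with h | h
    · rw [if_neg (by simp only [boundaryPos]; omega), if_pos (by simp only [boundaryPos]; omega)]
      decide
    · rw [if_pos (by simp only [boundaryPos]; omega), if_neg (by simp only [boundaryPos]; omega)]
      decide
  have mm : ∑ i, ∑ j, A (Sum.inr (Sum.inl i)) * B (Sum.inr (Sum.inl j)) *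
        before (n := n) (Sum.inr i) (Sum.inr j) =
      ∑ i, ∑ j, A (Sum.inr (Sum.inl i)) * B (Sum.inr (Sum.inl j)) *
        before (n := n) (Sum.inl i) (Sum.inl j) +
      (∑ i, A (Sum.inr (Sum.inl i))) * ∑ j, B (Sum.inr (Sum.inl j)) := by
    rw [Finset.sum_mul_sum, ← Finset.sum_add_distrib]
    refine Finset.sum_congr rfl fun i _ => ?_
    rw [← Finset.sum_add_distrib]
    refine Finset.sum_congr rfl fun j _ => ?_
    by_cases h : i = j
    · subst h; simp [hAB]
    · rw [b3 i j h]; ring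
  simp only [Fintype.sum_sum_type, upper_inl, upper_inr, lower_apply, outer_inl, outer_inr,
    b1, b2, mul_one, mul_zero, Finset.sum_const_zero,
    Finset.sum_add_distrib, ← Finset.mul_sum, ← Finset.sum_mul] at *
  rw [mm] at c1
  have two : (2 : ZMod 2) = 0 := by decide
  generalize ∑ i, A (Sum.inl i) = at' at *
  generalize ∑ i, A (Sum.inr (Sum.inl i)) = am at *
  generalize ∑ i, A (Sum.inr (Sum.inr i)) = ab at *
  generalize ∑ i, B (Sum.inl i) = bt at *
  generalize ∑ i, B (Sum.inr (Sum.inl i)) = bm at *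
  generalize ∑ i, B (Sum.inr (Sum.inr i)) = bb at *
  have ham : am = at' := by linear_combination pA1 - at' * two
  have hab : ab = at' := by linear_combination pA2 - pA1
  have hbm : bm = bt := by linear_combination pB1 - bt * two
  have hbb : bb = bt := by linear_combination pB2 - pB1
  subst ham hab hbm hbb
  refine ⟨pA2, ?_⟩
  generalize ∑ i, ∑ j, A (Sum.inr (Sum.inl i)) * B (Sum.inr (Sum.inl j)) *
    before (n := n) (Sum.inl i) (Sum.inl j) = m at *
  linear_combination c1 + c2 - (m + ab * bb) * two

open Classical in
/-- The indicator of the connected component of `u` in the stack. -/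
noncomputable def ind {n : ℕ} (d₁ d₂ : Diagram n) (u x : Stack n) : ZMod 2 :=
  if (stack d₁ d₂).Reachable u x then 1 else 0

theorem stack_adj_upper {n : ℕ} (d₁ d₂ : Diagram n) (v : Vertex n) :
    (stack d₁ d₂).Adj (upper n v) (upper n (d₁.partner v)) :=
  Or.inl ((SimpleGraph.map_adj _ _ _ _).2 ⟨v, _, d₁.adj_partner v, rfl, rfl⟩)

theorem stack_adj_lower {n : ℕ} (d₁ d₂ : Diagram n) (v : Vertex n) :
    (stack d₁ d₂).Adj (lower n v) (lower n (d₂.partner v)) :=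
  Or.inr ((SimpleGraph.map_adj _ _ _ _).2 ⟨v, _, d₂.adj_partner v, rfl, rfl⟩)

theorem ind_adj {n : ℕ} (d₁ d₂ : Diagram n) (u : Stack n) {x y : Stack n}
    (h : (stack d₁ d₂).Adj x y) : ind d₁ d₂ u y = ind d₁ d₂ u x := by
  unfold ind
  congr 1
  exact propext ⟨fun h' => h'.trans h.symm.reachable, fun h' => h'.trans h.reachable⟩

theorem compGraph_existsUnique {n : ℕ} (d₁ d₂ : Diagram n) (v : Vertex n) :
    ∃! w, (compGraph d₁ d₂).Adj v w := by
  suffices h : ∃ w, (compGraph d₁ d₂).Adj v w by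
    obtain ⟨w, hw⟩ := h
    exact ⟨w, hw, fun _ h => compGraph_unique h hw⟩
  by_contra! hno
  have h := (sum_outer d₁ d₂ (ind d₁ d₂ (outer n v)) (fun _ => 0)
    (fun v => ind_adj _ _ _ (stack_adj_upper d₁ d₂ v))
    (fun v => ind_adj _ _ _ (stack_adj_lower d₁ d₂ v))
    (fun _ => rfl) (fun _ => rfl) (fun _ => mul_zero _)).1
  rw [Finset.sum_eq_single v] at h
  · simp [ind] at h
  · intro w _ hw
    exact if_neg fun hr => hno w ⟨hw.symm, hr⟩
  · simp

theorem ind_outer {n : ℕ} {d₁ d₂ : Diagram n} {a b : Vertex n}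
    (h : (compGraph d₁ d₂).Adj a b) (v : Vertex n) :
    ind d₁ d₂ (outer n a) (outer n v) = (if v = a then 1 else 0) + (if v = b then 1 else 0) := by
  by_cases ha : v = a
  · subst ha
    simp [ind, h.1]
  · by_cases hb : v = b
    · subst hb
      simp [ind, ha, h.2]
    · have : ¬ (stack d₁ d₂).Reachable (outer n a) (outer n v) := fun hr =>
        hb (compGraph_unique (u := a) ⟨Ne.symm ha, hr⟩ h)
      simp [ind, ha, hb, this]

theorem compGraph_noncrossing {n : ℕ} (d₁ d₂ : Diagram n) (a b c d : Vertex n)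
    (hab : (compGraph d₁ d₂).Adj a b) (hcd : (compGraph d₁ d₂).Adj c d) :
    ¬ (boundaryPos a < boundaryPos c ∧ boundaryPos c < boundaryPos b ∧
      boundaryPos b < boundaryPos d) := by
  rintro ⟨h1, h2, h3⟩
  have hac : ¬ (stack d₁ d₂).Reachable (outer n a) (outer n c) := fun hr => by
    have hne : a ≠ c := by rintro rfl; exact lt_irrefl _ h1
    have : b = c := compGraph_unique hab ⟨hne, hr⟩
    subst this; exact lt_irrefl _ h2
  have h := (sum_outer d₁ d₂ (ind d₁ d₂ (outer n a)) (ind d₁ d₂ (outer n c))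
    (fun v => ind_adj _ _ _ (stack_adj_upper d₁ d₂ v))
    (fun v => ind_adj _ _ _ (stack_adj_lower d₁ d₂ v))
    (fun v => ind_adj _ _ _ (stack_adj_upper d₁ d₂ v))
    (fun v => ind_adj _ _ _ (stack_adj_lower d₁ d₂ v))
    (fun x => by
      unfold ind
      split_ifs with p q <;> first | exact absurd (p.trans q.symm) hac | simp)).2
  simp only [ind_outer hab, ind_outer hcd, add_mul, mul_add, Finset.sum_add_distrib,
    ite_mul, mul_ite, one_mul, mul_one, zero_mul, mul_zero, Finset.sum_ite_eq',
    Finset.mem_univ, if_true] at h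
  have e1 : before a c = 1 := if_pos h1
  have e2 : before a d = 1 := if_pos (by omega)
  have e3 : before b c = 0 := if_neg (by omega)
  have e4 : before b d = 1 := if_pos h3
  simp [e1, e2, e3, e4] at h
  revert h; decide

/-- The diagram obtained by stacking `d₁` on top of `d₂` and removing the middle data. -/
def comp {n : ℕ} (d₁ d₂ : Diagram n) : Diagram n where
  graph := compGraph d₁ d₂
  existsUnique_adj := compGraph_existsUnique d₁ d₂
  noncrossing := compGraph_noncrossing d₁ d₂

/-! Associativity of stacking, by counting two-colorings. -/

/-- A vertex coloring that is constant along the edges. -/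
def Compatible {V : Type*} (G : SimpleGraph V) (o : V → Bool) : Prop :=
  ∀ v w, G.Adj v w → o v = o w

theorem Compatible.reach {V : Type*} {G : SimpleGraph V} {o : V → Bool} (h : Compatible G o)
    {v w : V} (hr : G.Reachable v w) : o v = o w := by
  rw [SimpleGraph.reachable_iff_reflTransGen] at hr
  induction hr with
  | refl => rfl
  | tail _ hs ih => exact ih.trans (h _ _ hs)

theorem stack_compatible {n : ℕ} (d₁ d₂ : Diagram n) (a b c : Fin n → Bool) :
    Compatible (stack d₁ d₂) (Sum.elim a (Sum.elim c b)) ↔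
      Compatible d₁.graph (Sum.elim a c) ∧ Compatible d₂.graph (Sum.elim c b) := by
  have hu : ∀ v, Sum.elim a (Sum.elim c b) (upper n v) = Sum.elim a c v := by
    rintro (v | v) <;> rfl
  constructor
  · intro h
    refine ⟨fun v w hvw => ?_, fun v w hvw => ?_⟩
    · rw [← hu, ← hu]
      exact h _ _ (Or.inl ((SimpleGraph.map_adj _ _ _ _).2 ⟨v, w, hvw, rfl, rfl⟩))
    · exact h (Sum.inr v) (Sum.inr w)
        (Or.inr ((SimpleGraph.map_adj _ _ _ _).2 ⟨v, w, hvw, rfl, rfl⟩))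
  · rintro ⟨h1, h2⟩ x y h
    rw [stack, SimpleGraph.sup_adj, SimpleGraph.map_adj, SimpleGraph.map_adj] at h
    rcases h with ⟨u, v, h, rfl, rfl⟩ | ⟨u, v, h, rfl, rfl⟩
    · rw [hu, hu]; exact h1 _ _ h
    · exact h2 _ _ h

open Classical in
/-- The extension to the stack of a coloring of the outer vertices and of the loops. -/
noncomputable def extend {n : ℕ} (d₁ d₂ : Diagram n) (o : Vertex n → Bool)
    (g : {C : (stack d₁ d₂).ConnectedComponent //
      ∀ v, (stack d₁ d₂).connectedComponentMk (outer n v) ≠ C} → Bool) (x : Stack n) : Bool :=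
  if h : ∃ v, (stack d₁ d₂).connectedComponentMk (outer n v) =
      (stack d₁ d₂).connectedComponentMk x then o h.choose
  else g ⟨(stack d₁ d₂).connectedComponentMk x, fun v hv => h ⟨v, hv⟩⟩

theorem extend_compatible {n : ℕ} (d₁ d₂ : Diagram n) (o : Vertex n → Bool)
    (g : {C : (stack d₁ d₂).ConnectedComponent //
      ∀ v, (stack d₁ d₂).connectedComponentMk (outer n v) ≠ C} → Bool) :
    Compatible (stack d₁ d₂) (extend d₁ d₂ o g) := by
  classical
  intro x y h
  have : (stack d₁ d₂).connectedComponentMk x = (stack d₁ d₂).connectedComponentMk y :=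
    SimpleGraph.ConnectedComponent.sound h.reachable
  exact congrArg (fun C : (stack d₁ d₂).ConnectedComponent =>
    if h : ∃ v, (stack d₁ d₂).connectedComponentMk (outer n v) = C then o h.choose
    else g ⟨C, fun v hv => h ⟨v, hv⟩⟩) this

theorem extend_outer {n : ℕ} (d₁ d₂ : Diagram n) (o : Vertex n → Bool)
    (ho : Compatible (comp d₁ d₂).graph o)
    (g : {C : (stack d₁ d₂).ConnectedComponent //
      ∀ v, (stack d₁ d₂).connectedComponentMk (outer n v) ≠ C} → Bool) (v : Vertex n) :
    extend d₁ d₂ o g (outer n v) = o v := by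
  have h : ∃ w, (stack d₁ d₂).connectedComponentMk (outer n w) =
      (stack d₁ d₂).connectedComponentMk (outer n v) := ⟨v, rfl⟩
  rw [extend, dif_pos h]
  by_cases he : h.choose = v
  · rw [he]
  · exact ho _ _ ⟨he, SimpleGraph.ConnectedComponent.exact h.choose_spec⟩

theorem card_compatible {n : ℕ} (d₁ d₂ : Diagram n) (a b : Fin n → Bool)
    (ho : Compatible (comp d₁ d₂).graph (Sum.elim a b)) :
    Nat.card {c : Fin n → Bool // Compatible (stack d₁ d₂) (Sum.elim a (Sum.elim c b))} =
      2 ^ loops d₁ d₂ := by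
  have hext : ∀ g, Sum.elim a (Sum.elim (fun i => extend d₁ d₂ (Sum.elim a b) g
      (Sum.inr (Sum.inl i))) b) = extend d₁ d₂ (Sum.elim a b) g := by
    intro g
    ext (i | i | i)
    · exact (extend_outer d₁ d₂ _ ho g (Sum.inl i)).symm
    · rfl
    · exact (extend_outer d₁ d₂ _ ho g (Sum.inr i)).symm
  let e : {c : Fin n → Bool // Compatible (stack d₁ d₂) (Sum.elim a (Sum.elim c b))} ≃
      ({C : (stack d₁ d₂).ConnectedComponent //
        ∀ v, (stack d₁ d₂).connectedComponentMk (outer n v) ≠ C} → Bool) :=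
    { toFun := fun c C => Sum.elim a (Sum.elim c.1 b) C.1.out
      invFun := fun g => ⟨fun i => extend d₁ d₂ (Sum.elim a b) g (Sum.inr (Sum.inl i)), by
        rw [hext]; exact extend_compatible _ _ _ _⟩
      left_inv := by
        rintro ⟨c, hc⟩
        ext i
        simp only [extend]
        split_ifs with h
        · have h2 := hc.reach (SimpleGraph.ConnectedComponent.exact h.choose_spec)
          generalize h.choose = v at h2
          rcases v with v | v <;> exact h2
        · exact hc.reach (SimpleGraph.ConnectedComponent.exact (Quot.out_eq _))
      right_inv := by
        intro g
        ext C
        simp only [hext]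
        have hC : (stack d₁ d₂).connectedComponentMk C.1.out = C.1 := Quot.out_eq _
        have : ¬ ∃ v, (stack d₁ d₂).connectedComponentMk (outer n v) =
            (stack d₁ d₂).connectedComponentMk C.1.out := by
          rintro ⟨v, hv⟩; exact C.2 v (hv.trans hC)
        rw [extend, dif_neg this]
        congr 1
        exact Subtype.ext hC }
  rw [Nat.card_congr e, Nat.card_fun, Nat.card_eq_fintype_card (α := Bool), Fintype.card_bool,
    loops]

open Classical in
/-- The matrix of a diagram, indexed by the colorings of the top and the bottom line. -/
noncomputable def colorMatrix {n : ℕ} (d : Diagram n) :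
    Matrix (Fin n → Bool) (Fin n → Bool) ℕ :=
  Matrix.of fun a b => if Compatible d.graph (Sum.elim a b) then 1 else 0

theorem colorMatrix_mul {n : ℕ} (d₁ d₂ : Diagram n) :
    colorMatrix d₁ * colorMatrix d₂ = 2 ^ loops d₁ d₂ • colorMatrix (comp d₁ d₂) := by
  classical
  ext a b
  have h1 : (colorMatrix d₁ * colorMatrix d₂) a b =
      Nat.card {c : Fin n → Bool // Compatible (stack d₁ d₂) (Sum.elim a (Sum.elim c b))} := by
    rw [Matrix.mul_apply, Nat.card_eq_fintype_card, Fintype.card_subtype, Finset.card_filter]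
    refine Finset.sum_congr rfl fun c _ => ?_
    simp only [colorMatrix, Matrix.of_apply, stack_compatible]
    split_ifs <;> simp_all
  rw [h1]
  by_cases ho : Compatible (comp d₁ d₂).graph (Sum.elim a b)
  · rw [card_compatible d₁ d₂ a b ho]
    simp [colorMatrix, ho]
  · have : IsEmpty {c : Fin n → Bool //
        Compatible (stack d₁ d₂) (Sum.elim a (Sum.elim c b))} := by
      refine ⟨fun ⟨c, hc⟩ => ho fun v w hvw => ?_⟩
      have h2 := hc.reach hvw.2
      rcases v with v | v <;> rcases w with w | w <;> exact h2
    simp [colorMatrix, ho]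

theorem colorMatrix_injective {n : ℕ} {p q : ℕ} {d d' : Diagram n}
    (h : 2 ^ p • colorMatrix d = 2 ^ q • colorMatrix d') : p = q ∧ d = d' := by
  classical
  have hpq : p = q := by
    have h0 := congrFun (congrFun h (fun _ => false)) (fun _ => false)
    have hc : ∀ d : Diagram n,
        Compatible d.graph (Sum.elim (fun _ => false) (fun _ => false)) := by
      rintro d (v | v) (w | w) _ <;> rfl
    simp only [colorMatrix, Matrix.smul_apply, Matrix.of_apply, if_pos (hc _), smul_eq_mul,
      mul_one] at h0
    exact Nat.pow_right_injective le_rfl h0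
  refine ⟨hpq, ?_⟩
  subst hpq
  have hM : ∀ o : Vertex n → Bool, Compatible d.graph o ↔ Compatible d'.graph o := by
    intro o
    have h0 := congrFun (congrFun h (fun i => o (Sum.inl i))) (fun i => o (Sum.inr i))
    have ho : Sum.elim (fun i => o (Sum.inl i)) (fun i => o (Sum.inr i)) = o :=
      Sum.elim_comp_inl_inr o
    simp only [colorMatrix, Matrix.smul_apply, Matrix.of_apply, ho] at h0
    have h2 : 2 ^ p ≠ 0 := by positivity
    by_cases h3 : Compatible d.graph o <;> by_cases h4 : Compatible d'.graph o <;>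
      simp [h3, h4] at h0 ⊢
    omega
  have key : ∀ d d' : Diagram n,
      (∀ o : Vertex n → Bool, Compatible d.graph o ↔ Compatible d'.graph o) →
      ∀ v w, d.graph.Adj v w → d'.graph.Adj v w := by
    intro d d' hM v w hvw
    have hc : Compatible d.graph (fun x => decide (x = v ∨ x = w)) := by
      intro x y hxy
      have hw := (d.adj_iff _ _).1 hvw
      have hv := (d.adj_iff _ _).1 hvw.symm
      have hy := (d.adj_iff _ _).1 hxy
      have hx := (d.adj_iff _ _).1 hxy.symm
      simp only [decide_eq_decide]
      constructor
      · rintro (rfl | rfl)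
        · right; rw [hy, hw]
        · left; rw [hy, hv]
      · rintro (rfl | rfl)
        · right; rw [hx, hw]
        · left; rw [hx, hv]
    have := (hM _).1 hc v (d'.partner v) (d'.adj_partner v)
    simp [d'.partner_ne v] at this
    rw [adj_iff, this]
  ext v w
  exact ⟨key d d' hM v w, key d' d (fun o => (hM o).symm) v w⟩

theorem colorMatrix_id (n : ℕ) : colorMatrix (id n) = 1 := by
  classical
  ext a b
  rw [Matrix.one_apply, colorMatrix, Matrix.of_apply]
  congr 1
  refine propext ⟨fun h => ?_, ?_⟩
  · ext i
    have h1 : a i = b i := h (Sum.inl i) (Sum.inr i) (by simp [id])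
    rw [h1]
  · rintro rfl (v | v) (w | w) <;> simp [id] <;> rintro rfl <;> rfl

theorem comp_id {n : ℕ} (d : Diagram n) : loops d (id n) = 0 ∧ comp d (id n) = d := by
  apply colorMatrix_injective
  rw [← colorMatrix_mul, colorMatrix_id]; simp

theorem id_comp {n : ℕ} (d : Diagram n) : loops (id n) d = 0 ∧ comp (id n) d = d := by
  apply colorMatrix_injective
  rw [← colorMatrix_mul, colorMatrix_id]; simp

theorem comp_assoc {n : ℕ} (d₁ d₂ d₃ : Diagram n) :
    loops d₁ d₂ + loops (comp d₁ d₂) d₃ = loops d₂ d₃ + loops d₁ (comp d₂ d₃) ∧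
      comp (comp d₁ d₂) d₃ = comp d₁ (comp d₂ d₃) := by
  apply colorMatrix_injective
  have h := mul_assoc (colorMatrix d₁) (colorMatrix d₂) (colorMatrix d₃)
  rw [colorMatrix_mul, colorMatrix_mul, Matrix.smul_mul, Matrix.mul_smul, colorMatrix_mul,
    colorMatrix_mul, smul_smul, smul_smul, ← pow_add, ← pow_add] at h
  exact h

end Diagram

/-! ### The diagram algebra -/

/-- The diagram algebra `D_n(δ)`: the free `k`-module on the set of `n`-diagrams, with the
multiplication `d₁ d₂ = δ ^ L d₃`. -/
def DiagramAlgebra {k : Type*} [CommRing k] (n : ℕ) (_δ : k) : Type _ := Diagram n →₀ k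

namespace DiagramAlgebra

variable {k : Type*} [CommRing k] {n : ℕ} {δ : k}

noncomputable instance instAddCommGroup : AddCommGroup (DiagramAlgebra n δ) :=
  inferInstanceAs (AddCommGroup (Diagram n →₀ k))

noncomputable instance instModule : Module k (DiagramAlgebra n δ) :=
  inferInstanceAs (Module k (Diagram n →₀ k))

/-- The multiple `r d` of a diagram `d`. -/
noncomputable def single (δ : k) (d : Diagram n) (r : k) : DiagramAlgebra n δ :=
  Finsupp.single d r

/-- A diagram as an element of the diagram algebra. -/
noncomputable def ofDiagram (δ : k) (d : Diagram n) : DiagramAlgebra n δ := single δ d 1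

/-- The bilinear extension of the rule `d₁ d₂ = δ ^ L d₃`. -/
noncomputable instance instMul : Mul (DiagramAlgebra n δ) where
  mul a b := Finsupp.sum (M := k) a fun d₁ r => Finsupp.sum (M := k) b fun d₂ s =>
    single δ (d₁.comp d₂) (r * s * δ ^ d₁.loops d₂)

noncomputable instance instOne : One (DiagramAlgebra n δ) where
  one := ofDiagram δ (Diagram.id n)

theorem single_add (d : Diagram n) (r s : k) : single δ d (r + s) = single δ d r + single δ d s :=
  Finsupp.single_add d r s

theorem single_zero (d : Diagram n) : single δ d (0 : k) = 0 := Finsupp.single_zero d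

theorem smul_single (c r : k) (d : Diagram n) : c • single δ d r = single δ d (c * r) :=
  Finsupp.smul_single c d r

theorem induction {p : DiagramAlgebra n δ → Prop} (a : DiagramAlgebra n δ) (zero : p 0)
    (add : ∀ a b, p a → p b → p (a + b)) (single : ∀ d r, p (single δ d r)) : p a :=
  Finsupp.induction_linear a zero add single

theorem sum_const_zero (a : DiagramAlgebra n δ) :
    Finsupp.sum (M := k) a (fun _ _ => (0 : DiagramAlgebra n δ)) = 0 := Finset.sum_const_zero

theorem single_mul_single (d₁ d₂ : Diagram n) (r s : k) :
    single δ d₁ r * single δ d₂ s = single δ (d₁.comp d₂) (r * s * δ ^ d₁.loops d₂) := by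
  refine (Finsupp.sum_single_index ?_).trans (Finsupp.sum_single_index ?_)
  · exact (Finsupp.sum_congr fun _ _ => by rw [zero_mul, zero_mul, single_zero]).trans
      (sum_const_zero (single δ d₂ s))
  · rw [mul_zero, zero_mul, single_zero]

protected theorem zero_mul' (a : DiagramAlgebra n δ) : 0 * a = 0 := Finsupp.sum_zero_index

protected theorem mul_zero' (a : DiagramAlgebra n δ) : a * 0 = 0 :=
  (Finsupp.sum_congr fun _ _ => Finsupp.sum_zero_index).trans (sum_const_zero a)

protected theorem add_mul' (a b c : DiagramAlgebra n δ) : (a + b) * c = a * c + b * c := by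
  refine Finsupp.sum_add_index' (fun d => ?_) fun d r s => ?_
  · exact (Finsupp.sum_congr fun _ _ => by rw [zero_mul, zero_mul, single_zero]).trans
      (sum_const_zero c)
  · refine Eq.trans ?_ Finsupp.sum_add
    exact Finsupp.sum_congr fun _ _ => by rw [add_mul, add_mul, single_add]

protected theorem mul_add' (a b c : DiagramAlgebra n δ) : a * (b + c) = a * b + a * c := by
  refine Eq.trans (Finsupp.sum_congr fun d _ => ?_) Finsupp.sum_add
  refine Finsupp.sum_add_index' (fun d => ?_) fun d r s => ?_
  · rw [mul_zero, zero_mul, single_zero]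
  · rw [mul_add, add_mul, single_add]

protected theorem one_mul' (a : DiagramAlgebra n δ) : 1 * a = a := by
  induction a using induction with
  | zero => exact DiagramAlgebra.mul_zero' _
  | add a b ha hb => rw [DiagramAlgebra.mul_add', ha, hb]
  | single d r =>
    refine (single_mul_single _ _ _ _).trans ?_
    rw [(Diagram.id_comp d).1, (Diagram.id_comp d).2, pow_zero, mul_one, one_mul]

protected theorem mul_one' (a : DiagramAlgebra n δ) : a * 1 = a := by
  induction a using induction with
  | zero => exact DiagramAlgebra.zero_mul' _
  | add a b ha hb => rw [DiagramAlgebra.add_mul', ha, hb]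
  | single d r =>
    refine (single_mul_single _ _ _ _).trans ?_
    rw [(Diagram.comp_id d).1, (Diagram.comp_id d).2, pow_zero, mul_one, mul_one]

protected theorem mul_assoc' (a b c : DiagramAlgebra n δ) : a * b * c = a * (b * c) := by
  induction a using induction with
  | zero => simp only [DiagramAlgebra.zero_mul']
  | add a a' ha ha' => simp only [DiagramAlgebra.add_mul', ha, ha']
  | single d r =>
    induction b using induction with
    | zero => simp only [DiagramAlgebra.zero_mul', DiagramAlgebra.mul_zero']
    | add b b' hb hb' => simp only [DiagramAlgebra.add_mul', DiagramAlgebra.mul_add', hb, hb']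
    | single d' s =>
      induction c using induction with
      | zero => simp only [DiagramAlgebra.mul_zero']
      | add c c' hc hc' => simp only [DiagramAlgebra.mul_add', hc, hc']
      | single d'' t =>
        obtain ⟨h1, h2⟩ := Diagram.comp_assoc d d' d''
        simp only [single_mul_single, h2]
        congr 1
        have h3 : δ ^ d.loops d' * δ ^ (d.comp d').loops d'' =
            δ ^ d'.loops d'' * δ ^ d.loops (d'.comp d'') := by
          rw [← pow_add, h1, pow_add]
        linear_combination (r * s * t) * h3

noncomputable instance instRing : Ring (DiagramAlgebra n δ) where
  __ := instAddCommGroup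
  zero_mul := DiagramAlgebra.zero_mul'
  mul_zero := DiagramAlgebra.mul_zero'
  left_distrib := DiagramAlgebra.mul_add'
  right_distrib := DiagramAlgebra.add_mul'
  one_mul := DiagramAlgebra.one_mul'
  mul_one := DiagramAlgebra.mul_one'
  mul_assoc := DiagramAlgebra.mul_assoc'

noncomputable instance instAlgebra : Algebra k (DiagramAlgebra n δ) :=
  Algebra.ofModule
    (fun c a b => by
      induction a using induction with
      | zero => simp only [smul_zero, zero_mul]
      | add a a' ha ha' => simp only [smul_add, add_mul, ha, ha']
      | single d r =>
        induction b using induction with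
        | zero => simp only [smul_zero, mul_zero]
        | add b b' hb hb' => simp only [smul_add, mul_add, hb, hb']
        | single d' s =>
          simp only [smul_single, single_mul_single]
          congr 1; ring)
    (fun c a b => by
      induction a using induction with
      | zero => simp only [smul_zero, zero_mul]
      | add a a' ha ha' => simp only [smul_add, add_mul, ha, ha']
      | single d r =>
        induction b using induction with
        | zero => simp only [smul_zero, mul_zero]
        | add b b' hb hb' => simp only [smul_add, mul_add, hb, hb']
        | single d' s =>
          simp only [smul_single, single_mul_single]
          congr 1; ring)

/-- The element `ê_i` of the diagram algebra. -/
noncomputable def hatE (δ : k) (i : Fin (n - 1)) : DiagramAlgebra n δ :=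
  ofDiagram δ (Diagram.hatE i)

end DiagramAlgebra

end TemperleyLieb

/-!
A diagram is determined by its color matrix, the 0-1 matrix recording which colorings of the two
lines by two colors are constant along the edges. Stacking diagrams multiplies the color matrices,
and a loop becomes a factor `2`. The pair consisting of a diagram and a number of loops can
therefore be replaced by a matrix with natural entries, and both halves of the theorem become
statements about products of the matrices `hatMat n i` of the diagrams `ê_i`.

*The diagrams `ê_i` generate* (`Diagram.exists_list_colorMatrix`). A diagram other than the
identity has an edge `{j', (j + 1)'}` on its bottom line, a cup at `j`. Then `d` and
`d' = d ê_{j+1}` satisfy `d = d' ê_j`, as follows from `e_j e_{j+1} e_j = e_j`, and `d'` has a cup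
at `j + 1`. Thus the cup can be moved to the right until all vertices beyond it are straight. At
this place a cup is split off by a surgery that makes one more vertex straight (`Diagram.unCup`).

*There are no further relations* (`TLSystem.ρ_injOn`). Consider words in `x` and `e 0, …, e k`,
modulo the Temperley-Lieb relations. Each of them is a word without `e k`, or the product of such a
word `s` and a decreasing product `e k ⋯ e j` (`TLSystem.words_succ`). Cups can be detected in
the words: if the matrix of a word has a cup at `j`, then the word is equal to a word ending in
`e j` (`TLSystem.exists_eq_mul_e`). If two words have the same matrix and one of them is
`s e k ⋯ e j`, then both have a cup at `j`, and right multiplication by `e (j + 1) ⋯ e k` is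
reversible on both. It leads to words `s e k` and `p e k`, where `p`, too, does not involve
`e k`. Since the matrices of `s` and `p` act trivially at the vertex `k + 1`, they can be recovered
from those of `s e k` and `p e k` (`TrivialAt.mul_hatMat_cancel`), and `s = p` by induction on `k`.

This is applied to the generators of `TL_n(δ)` paired with their color matrices. Each diagram
has a unique lift to `TL_n(δ)`, and uniqueness shows that the linear extension of the lifting is
inverse to the morphism `TL_n(δ) → D_n(δ)`, for every `δ`.
-/

/-! ### Color matrices -/

namespace TemperleyLieb

namespace Diagram

/-- Two vertices are joined by an edge as soon as every compatible coloring gives them the same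
color: color one edge differently from all the others. -/
theorem adj_of_forall_compatible {n : ℕ} (d : Diagram n) {v w : Vertex n} (hvw : v ≠ w)
    (h : ∀ o : Vertex n → Bool, Compatible d.graph o → o v = o w) : d.graph.Adj v w := by
  have hc : Compatible d.graph (fun u => decide (u = v ∨ u = d.partner v)) := by
    intro y z hyz
    have hz := (d.adj_iff _ _).1 hyz
    have hy := (d.adj_iff _ _).1 hyz.symm
    simp only [decide_eq_decide]
    constructor
    · rintro (rfl | rfl)
      · exact Or.inr hz
      · left; rw [hz, d.partner_partner]
    · rintro (rfl | rfl)
      · exact Or.inr hy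
      · left; rw [hy, d.partner_partner]
  have h1 := h _ hc
  simp only [true_or, decide_true, eq_comm (a := true), decide_eq_true_eq] at h1
  exact (d.adj_iff _ _).2 (h1.resolve_left hvw.symm)

/-- Recoloring both endpoints of an edge with a common color preserves compatibility. -/
theorem Compatible.recolor {n : ℕ} {d : Diagram n} {v w : Vertex n} (hvw : d.graph.Adj v w)
    {o o' : Vertex n → Bool} (ho : Compatible d.graph o) (h : o' v = o' w)
    (heq : ∀ u, u ≠ v → u ≠ w → o' u = o u) : Compatible d.graph o' := by
  intro y z hyz
  have hw := (d.adj_iff _ _).1 hvw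
  have hv := (d.adj_iff _ _).1 hvw.symm
  have hz := (d.adj_iff _ _).1 hyz
  have hy := (d.adj_iff _ _).1 hyz.symm
  by_cases h1 : y = v
  · subst h1; rw [hz, ← hw, h]
  by_cases h2 : y = w
  · subst h2; rw [hz, ← hv, h]
  have h3 : z ≠ v := by rintro rfl; exact h2 (hy.trans hw.symm)
  have h4 : z ≠ w := by rintro rfl; exact h1 (hy.trans hv.symm)
  rw [heq y h1 h2, heq z h3 h4]
  exact ho y z hyz

theorem colorMatrix_eq_zero_iff {n : ℕ} (d : Diagram n) (a b : Fin n → Bool) :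
    colorMatrix d a b = 0 ↔ ¬ Compatible d.graph (Sum.elim a b) := by
  simp [colorMatrix]

theorem colorMatrix_congr {n : ℕ} {d d' : Diagram n} {a b a' b' : Fin n → Bool}
    (h : Compatible d.graph (Sum.elim a b) ↔ Compatible d'.graph (Sum.elim a' b')) :
    colorMatrix d a b = colorMatrix d' a' b' := by
  simp only [colorMatrix, Matrix.of_apply]
  congr 1
  exact propext h

theorem compatible_hatE {n : ℕ} (i : Fin (n - 1)) (a b : Fin n → Bool) :
    Compatible (hatE i).graph (Sum.elim a b) ↔
      a ⟨i, by omega⟩ = a ⟨i + 1, by omega⟩ ∧ b ⟨i, by omega⟩ = b ⟨i + 1, by omega⟩ ∧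
        ∀ j : Fin n, (j : ℕ) ≠ i → (j : ℕ) ≠ i + 1 → a j = b j := by
  constructor
  · intro h
    refine ⟨h (Sum.inl _) (Sum.inl _) ?_, h (Sum.inr _) (Sum.inr _) ?_,
      fun j h1 h2 => h (Sum.inl j) (Sum.inr j) ?_⟩ <;> simp_all [hatE]
  · rintro ⟨h1, h2, h3⟩ (v | v) (w | w) hvw <;>
      simp [hatE] at hvw
    · rcases hvw.1 with ⟨rfl, rfl⟩ | ⟨rfl, rfl⟩
      · exact h1
      · exact h1.symm
    · obtain ⟨h4, h5, rfl⟩ := hvw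
      exact h3 _ h4 h5
    · obtain ⟨h4, h5, rfl⟩ := hvw
      exact (h3 _ h4 h5).symm
    · rcases hvw.1 with ⟨rfl, rfl⟩ | ⟨rfl, rfl⟩
      · exact h2
      · exact h2.symm

end Diagram

/-- Matrices indexed by the colorings of a line of `n` vertices. The maps `d ↦ colorMatrix d` and
`loop ↦ 2` embed the diagrams, together with a count of loops, in the monoid of these matrices. -/
abbrev ColorMat (n : ℕ) : Type := Matrix (Fin n → Bool) (Fin n → Bool) ℕ

/-- The color matrix of `ê_m`, with `m` a natural number; the value is `1` when `m + 1 < n`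
fails. -/
noncomputable def hatMat (n m : ℕ) : ColorMat n :=
  if h : m < n - 1 then Diagram.colorMatrix (Diagram.hatE ⟨m, h⟩) else 1

/-- The coloring that agrees with `b` except at `m` and `m + 1`, which receive the color `v`. -/
def setPair {n : ℕ} (b : Fin n → Bool) (m : ℕ) (v : Bool) : Fin n → Bool :=
  fun t => if (t : ℕ) = m ∨ (t : ℕ) = m + 1 then v else b t

theorem hatMat_of_lt {n m : ℕ} (h : m < n - 1) :
    hatMat n m = Diagram.colorMatrix (Diagram.hatE ⟨m, h⟩) := dif_pos h

/-- Right multiplication by the matrix of `ê_m`, entry by entry. -/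
theorem mul_hatMat_apply {n m : ℕ} (h : m + 1 < n) (M : ColorMat n) (a b : Fin n → Bool) :
    (M * hatMat n m) a b = if b ⟨m, by omega⟩ = b ⟨m + 1, h⟩ then
      M a (setPair b m true) + M a (setPair b m false) else 0 := by
  classical
  rw [hatMat_of_lt (by omega), Matrix.mul_apply]
  have key : ∀ c, Diagram.colorMatrix (Diagram.hatE (⟨m, by omega⟩ : Fin (n - 1))) c b =
      if b ⟨m, by omega⟩ = b ⟨m + 1, h⟩ then
        (if c = setPair b m true then 1 else 0) + (if c = setPair b m false then 1 else 0)
      else 0 := by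
    intro c
    rw [Diagram.colorMatrix, Matrix.of_apply]
    by_cases hb : b ⟨m, by omega⟩ = b ⟨m + 1, h⟩
    swap
    · rw [if_neg hb, if_neg fun hc => hb ((Diagram.compatible_hatE _ _ _).1 hc).2.1]
    have hset : ∀ v, c = setPair b m v ↔
        (Diagram.Compatible (Diagram.hatE (⟨m, by omega⟩ : Fin (n - 1))).graph (Sum.elim c b) ∧
          c ⟨m, by omega⟩ = v) := by
      intro v
      rw [Diagram.compatible_hatE]
      constructor
      · rintro rfl
        refine ⟨⟨by simp [setPair], hb, fun j h1 h2 => ?_⟩, by simp [setPair]⟩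
        simp only [setPair]
        rw [if_neg]
        rintro (h3 | h3)
        · exact h1 h3
        · exact h2 h3
      · rintro ⟨⟨h1, -, h3⟩, rfl⟩
        ext t
        simp only [setPair]
        split_ifs with ht
        · rcases ht with ht | ht
          · exact congrArg c (Fin.ext ht)
          · rw [h1]; exact congrArg c (Fin.ext ht)
        · exact h3 t (fun h => ht (Or.inl h)) (fun h => ht (Or.inr h))
    rw [if_pos hb]
    simp only [hset]
    by_cases hc : Diagram.Compatible (Diagram.hatE (⟨m, by omega⟩ : Fin (n - 1))).graph
        (Sum.elim c b)
    · cases hcm : c ⟨m, by omega⟩ <;> simp [hc]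
    · simp [hc]
  simp only [key]
  split_ifs with hb
  · simp [mul_add, Finset.sum_add_distrib]
  · simp

/-! #### The Temperley-Lieb relations for the matrices -/

theorem hatMat_sq {n i : ℕ} (h : i + 1 < n) : hatMat n i * hatMat n i = 2 * hatMat n i := by
  suffices H : ∀ M : ColorMat n, M * hatMat n i * hatMat n i = 2 • (M * hatMat n i) by
    have := H 1
    rw [one_mul] at this
    rw [this, two_smul, two_mul]
  intro M
  ext a b
  have h2 : ∀ v w, setPair (setPair b i v) i w = setPair b i w := by
    intro v w; ext t; simp only [setPair]; split_ifs <;> rfl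
  simp only [Matrix.smul_apply, mul_hatMat_apply h, h2]
  simp [setPair, two_mul]

theorem hatMat_far {n i j : ℕ} (hij : i + 1 < j) (h : j + 1 < n) :
    hatMat n i * hatMat n j = hatMat n j * hatMat n i := by
  suffices H : ∀ M : ColorMat n, M * hatMat n i * hatMat n j = M * hatMat n j * hatMat n i by
    simpa using H 1
  intro M
  have hi : i + 1 < n := by omega
  ext a b
  have h2 : ∀ v w, setPair (setPair b i v) j w = setPair (setPair b j w) i v := by
    intro v w; ext t; simp only [setPair]; split_ifs <;> first | rfl | omega
  simp only [mul_hatMat_apply hi, mul_hatMat_apply h, h2]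
  have h3 : ∀ v, setPair b j v ⟨i, by omega⟩ = b ⟨i, by omega⟩ := fun v => if_neg (by simp; omega)
  have h4 : ∀ v, setPair b j v ⟨i + 1, hi⟩ = b ⟨i + 1, hi⟩ := fun v => if_neg (by simp; omega)
  have h5 : ∀ v, setPair b i v ⟨j, by omega⟩ = b ⟨j, by omega⟩ := fun v => if_neg (by simp; omega)
  have h6 : ∀ v, setPair b i v ⟨j + 1, h⟩ = b ⟨j + 1, h⟩ := fun v => if_neg (by simp; omega)
  simp only [h3, h4, h5, h6]
  split_ifs <;> ring

theorem hatMat_up {n i : ℕ} (h : i + 2 < n) :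
    hatMat n i * hatMat n (i + 1) * hatMat n i = hatMat n i := by
  suffices H : ∀ M : ColorMat n,
      M * hatMat n i * hatMat n (i + 1) * hatMat n i = M * hatMat n i by
    simpa using H 1
  intro M
  have hi : i + 1 < n := by omega
  have h' : i + 1 + 1 < n := by omega
  ext a b
  simp only [mul_hatMat_apply hi, mul_hatMat_apply h']
  have e1 : ∀ v, setPair b i v ⟨i + 1, hi⟩ = v := fun v => if_pos (by simp)
  have e2 : ∀ v, setPair b i v ⟨i + 1 + 1, h'⟩ = b ⟨i + 1 + 1, h'⟩ :=
    fun v => if_neg (by simp only; omega)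
  have e3 : ∀ v w, setPair (setPair b i v) (i + 1) w ⟨i, by omega⟩ = v :=
    fun v w => (if_neg (by simp only; omega)).trans (if_pos (by simp))
  have e4 : ∀ v w, setPair (setPair b i v) (i + 1) w ⟨i + 1, hi⟩ = w := fun v w => if_pos (by simp)
  have e5 : ∀ v w, setPair (setPair (setPair b i v) (i + 1) (b ⟨i + 1 + 1, h'⟩)) i w =
      setPair b i w := by
    intro v w; ext t; simp only [setPair]
    split_ifs <;> first | rfl | exact congrArg b (Fin.ext (by simp only; omega))
  simp only [e1, e2, e3, e4]
  by_cases hb : b ⟨i, by omega⟩ = b ⟨i + 1, hi⟩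
  · rw [if_pos hb, if_pos hb]
    cases hc : b ⟨i + 1 + 1, h'⟩ <;> rw [hc] at e5 <;> simp [e5]
  · rw [if_neg hb, if_neg hb]

theorem hatMat_down {n i : ℕ} (h : i + 2 < n) :
    hatMat n (i + 1) * hatMat n i * hatMat n (i + 1) = hatMat n (i + 1) := by
  suffices H : ∀ M : ColorMat n,
      M * hatMat n (i + 1) * hatMat n i * hatMat n (i + 1) = M * hatMat n (i + 1) by
    simpa using H 1
  intro M
  have hi : i + 1 < n := by omega
  have h' : i + 1 + 1 < n := by omega
  ext a b
  simp only [mul_hatMat_apply hi, mul_hatMat_apply h']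
  have e1 : ∀ v, setPair b (i + 1) v ⟨i + 1, hi⟩ = v := fun v => if_pos (by simp)
  have e2 : ∀ v, setPair b (i + 1) v ⟨i, by omega⟩ = b ⟨i, by omega⟩ :=
    fun v => if_neg (by simp only; omega)
  have e3 : ∀ v w, setPair (setPair b (i + 1) v) i w ⟨i + 1 + 1, h'⟩ = v :=
    fun v w => (if_neg (by simp only; omega)).trans (if_pos (by simp))
  have e4 : ∀ v w, setPair (setPair b (i + 1) v) i w ⟨i + 1, hi⟩ = w := fun v w => if_pos (by simp)
  have e5 : ∀ v w, setPair (setPair (setPair b (i + 1) v) i (b ⟨i, by omega⟩)) (i + 1) w =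
      setPair b (i + 1) w := by
    intro v w; ext t; simp only [setPair]
    split_ifs <;> first | rfl | exact congrArg b (Fin.ext (by simp only; omega))
  simp only [e1, e2, e3, e4]
  by_cases hb : b ⟨i + 1, hi⟩ = b ⟨i + 1 + 1, h'⟩
  · rw [if_pos hb, if_pos hb]
    cases hc : b ⟨i, by omega⟩ <;> rw [hc] at e5 <;> simp [e5]
  · rw [if_neg hb, if_neg hb]

/-! ### Matrices acting trivially at one vertex -/

/-- The coloring with the color at `p` changed. -/
def flipAt {n : ℕ} (p : Fin n) (a : Fin n → Bool) : Fin n → Bool := Function.update a p (!a p)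

theorem flipAt_self {n : ℕ} (p : Fin n) (a : Fin n → Bool) : flipAt p a p = !a p := by
  simp [flipAt]

theorem flipAt_of_ne {n : ℕ} {p t : Fin n} (h : t ≠ p) (a : Fin n → Bool) :
    flipAt p a t = a t := by
  simp [flipAt, h]

theorem flipAt_involutive {n : ℕ} (p : Fin n) : Function.Involutive (flipAt p) := by
  intro a; ext t
  by_cases h : t = p
  · subst h; simp [flipAt_self]
  · simp [flipAt_of_ne h]

/-- `M` acts as the identity on the color at `p`: it preserves this color, and its other effects
do not depend on it. For the matrix of a diagram this means that `{p, p'}` is an edge. -/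
structure TrivialAt {n : ℕ} (p : Fin n) (M : ColorMat n) : Prop where
  eq_zero : ∀ a b, a p ≠ b p → M a b = 0
  flip : ∀ a b, M (flipAt p a) (flipAt p b) = M a b

namespace TrivialAt

variable {n : ℕ} {p : Fin n}

theorem mul {M N : ColorMat n} (hM : TrivialAt p M) (hN : TrivialAt p N) :
    TrivialAt p (M * N) := by
  constructor
  · intro a b hab
    rw [Matrix.mul_apply]
    refine Finset.sum_eq_zero fun c _ => ?_
    by_cases h : a p = c p
    · rw [hN.eq_zero c b (by rwa [← h]), mul_zero]
    · rw [hM.eq_zero a c h, zero_mul]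
  · intro a b
    rw [Matrix.mul_apply, Matrix.mul_apply,
      ← Equiv.sum_comp (Function.Involutive.toPerm _ (flipAt_involutive p))]
    exact Finset.sum_congr rfl fun c _ => congrArg₂ (· * ·) (hM.flip a c) (hN.flip c b)

theorem one : TrivialAt p (1 : ColorMat n) := by
  constructor
  · intro a b hab
    exact Matrix.one_apply_ne (by rintro rfl; exact hab rfl)
  · intro a b
    simp only [Matrix.one_apply, (flipAt_involutive p).injective.eq_iff]

theorem add {M N : ColorMat n} (hM : TrivialAt p M) (hN : TrivialAt p N) :
    TrivialAt p (M + N) :=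
  ⟨fun a b h => by rw [Matrix.add_apply, hM.eq_zero a b h, hN.eq_zero a b h],
    fun a b => by rw [Matrix.add_apply, hM.flip, hN.flip, Matrix.add_apply]⟩

theorem two : TrivialAt p (2 : ColorMat n) := one_add_one_eq_two (R := ColorMat n) ▸ one.add one

theorem colorMatrix {d : Diagram n} (h : d.graph.Adj (Sum.inl p) (Sum.inr p)) :
    TrivialAt p (Diagram.colorMatrix d) := by
  constructor
  · intro a b hab
    rw [Diagram.colorMatrix_eq_zero_iff]
    exact fun hc => hab (hc _ _ h)
  · intro a b
    have key : ∀ a b : Fin n → Bool, Diagram.Compatible d.graph (Sum.elim a b) →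
        Diagram.Compatible d.graph (Sum.elim (flipAt p a) (flipAt p b)) := by
      intro a b hab
      refine hab.recolor h ?_ ?_
      · simpa [flipAt_self] using hab _ _ h
      · rintro (u | u) h1 h2
        · exact flipAt_of_ne (fun h => h1 (by rw [h])) _
        · exact flipAt_of_ne (fun h => h2 (by rw [h])) _
    refine Diagram.colorMatrix_congr ⟨fun hc => ?_, key a b⟩
    simpa only [flipAt_involutive p a, flipAt_involutive p b] using key _ _ hc

theorem adj {d : Diagram n} (h : TrivialAt p (Diagram.colorMatrix d)) :
    d.graph.Adj (Sum.inl p) (Sum.inr p) := by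
  refine d.adj_of_forall_compatible (by simp) fun o ho => ?_
  by_contra hne
  have h0 := h.eq_zero (fun i => o (Sum.inl i)) (fun i => o (Sum.inr i)) hne
  rw [Diagram.colorMatrix_eq_zero_iff] at h0
  exact h0 (by rwa [show Sum.elim (fun i => o (Sum.inl i)) (fun i => o (Sum.inr i)) = o from
    Sum.elim_comp_inl_inr o])

theorem hatMat {m : ℕ} (h1 : (p : ℕ) ≠ m) (h2 : (p : ℕ) ≠ m + 1) :
    TrivialAt p (hatMat n m) := by
  by_cases h : m < n - 1
  · rw [hatMat_of_lt h]
    refine colorMatrix ?_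
    simp [Diagram.hatE, h1, h2]
  · rw [TemperleyLieb.hatMat, dif_neg h]
    exact one

/-- A matrix that acts trivially at `m + 1` is determined by its product with the matrix of
`ê_m`. -/
theorem mul_hatMat_cancel {m : ℕ} (h : m + 1 < n) {M N : ColorMat n}
    (hM : TrivialAt ⟨m + 1, h⟩ M) (hN : TrivialAt ⟨m + 1, h⟩ N)
    (hMN : M * TemperleyLieb.hatMat n m = N * TemperleyLieb.hatMat n m) : M = N := by
  have key : ∀ {M : ColorMat n}, TrivialAt ⟨m + 1, h⟩ M → ∀ a b : Fin n → Bool,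
      a ⟨m + 1, h⟩ = b ⟨m + 1, h⟩ → b ⟨m, by omega⟩ = b ⟨m + 1, h⟩ →
      (M * TemperleyLieb.hatMat n m) a b = M a b := by
    intro M hM a b h1 h2
    have hset : setPair b m (b ⟨m + 1, h⟩) = b := by
      ext t; simp only [setPair]
      split_ifs with ht
      · rcases ht with ht | ht
        · rw [← h2]; exact congrArg b (Fin.ext ht.symm)
        · exact congrArg b (Fin.ext ht.symm)
      · rfl
    have hzero : M a (setPair b m (!b ⟨m + 1, h⟩)) = 0 :=
      hM.eq_zero _ _ (by simp [setPair, h1])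
    rw [mul_hatMat_apply h, if_pos h2]
    cases hb : b ⟨m + 1, h⟩ <;> rw [hb] at hset hzero <;> simp_all
  have hne : (⟨m, by omega⟩ : Fin n) ≠ ⟨m + 1, h⟩ := by simp
  ext a b
  by_cases h1 : a ⟨m + 1, h⟩ = b ⟨m + 1, h⟩
  · by_cases h2 : b ⟨m, by omega⟩ = b ⟨m + 1, h⟩
    · rw [← key hM a b h1 h2, hMN, key hN a b h1 h2]
    · rw [← hM.flip, ← hN.flip]
      have h3 : flipAt ⟨m + 1, h⟩ a ⟨m + 1, h⟩ = flipAt ⟨m + 1, h⟩ b ⟨m + 1, h⟩ := by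
        rw [flipAt_self, flipAt_self, h1]
      have h4 : flipAt ⟨m + 1, h⟩ b ⟨m, by omega⟩ = flipAt ⟨m + 1, h⟩ b ⟨m + 1, h⟩ := by
        rw [flipAt_self, flipAt_of_ne hne]
        exact Bool.eq_not.2 h2
      rw [← key hM _ _ h3 h4, hMN, key hN _ _ h3 h4]
  · rw [hM.eq_zero a b h1, hN.eq_zero a b h1]

/-- A nonzero matrix that acts trivially at `m + 1` does not act as the matrix of a diagram with a
bottom edge `{m', (m + 1)'}`. -/
theorem not_mul_hatMat {m : ℕ} (h : m + 1 < n) {M : ColorMat n} (hM : TrivialAt ⟨m + 1, h⟩ M)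
    (h0 : 0 < M (fun _ => false) (fun _ => false)) :
    M * TemperleyLieb.hatMat n m ≠ 2 * M := by
  intro hc
  have hc := congrFun (congrFun hc (flipAt ⟨m + 1, h⟩ fun _ => false))
    (flipAt ⟨m + 1, h⟩ fun _ => false)
  rw [two_mul, Matrix.add_apply, hM.flip, mul_hatMat_apply h, if_neg] at hc
  · omega
  · rw [flipAt_self, flipAt_of_ne (by simp)]
    simp

end TrivialAt

theorem mul_apply_false_pos {n : ℕ} {M N : ColorMat n}
    (hM : 0 < M (fun _ => false) (fun _ => false))
    (hN : 0 < N (fun _ => false) (fun _ => false)) :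
    0 < (M * N) (fun _ => false) (fun _ => false) := by
  rw [Matrix.mul_apply]
  exact Finset.sum_pos' (fun _ _ => Nat.zero_le _)
    ⟨fun _ => false, Finset.mem_univ _, Nat.mul_pos hM hN⟩

theorem colorMatrix_apply_false_pos {n : ℕ} (d : Diagram n) :
    0 < Diagram.colorMatrix d (fun _ => false) (fun _ => false) := by
  have hc : Diagram.Compatible d.graph (Sum.elim (fun _ => false) (fun _ => false)) := by
    rintro (v | v) (w | w) _ <;> rfl
  exact Nat.pos_of_ne_zero fun h => (Diagram.colorMatrix_eq_zero_iff _ _ _).1 h hc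

theorem hatMat_apply_false_pos (n m : ℕ) :
    0 < hatMat n m (fun _ => false) (fun _ => false) := by
  by_cases h : m < n - 1
  · rw [hatMat_of_lt h]; exact colorMatrix_apply_false_pos _
  · rw [hatMat, dif_neg h]; simp

end TemperleyLieb

/-! ### Words in the Temperley-Lieb generators -/

namespace TemperleyLieb

/-- A monoid `A` with elements `e 0, …, e (n - 2)` and a central element `x` that satisfy the
Temperley-Lieb relations, with `x` in place of `δ`, together with a compatible homomorphism to
the color matrices. The values `e i` with `n ≤ i + 1` are unconstrained. -/
structure TLSystem (n : ℕ) (A : Type*) [Monoid A] where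
  e : ℕ → A
  x : A
  x_comm : ∀ a, x * a = a * x
  sq : ∀ i, i + 1 < n → e i * e i = x * e i
  up : ∀ i, i + 2 < n → e i * e (i + 1) * e i = e i
  down : ∀ i, i + 2 < n → e (i + 1) * e i * e (i + 1) = e (i + 1)
  far : ∀ i j, i + 1 < j → j + 1 < n → e i * e j = e j * e i
  ρ : A →* ColorMat n
  ρ_x : ρ x = 2
  ρ_e : ∀ i, i + 1 < n → ρ (e i) = hatMat n i

namespace TLSystem

variable {n : ℕ} {A : Type*} [Monoid A] (S : TLSystem n A)

/-- The submonoid generated by `x` and the first `k` generators `e 0, …, e (k - 1)`. -/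
def words (k : ℕ) : Submonoid A := Submonoid.closure ({S.x} ∪ {a | ∃ i < k, a = S.e i})

theorem x_mem (k : ℕ) : S.x ∈ S.words k := Submonoid.subset_closure (Or.inl rfl)

theorem e_mem {i k : ℕ} (h : i < k) : S.e i ∈ S.words k :=
  Submonoid.subset_closure (Or.inr ⟨i, h, rfl⟩)

theorem words_mono {k l : ℕ} (h : k ≤ l) : S.words k ≤ S.words l := by
  refine Submonoid.closure_mono (Set.union_subset_union_right _ ?_)
  rintro a ⟨i, hi, rfl⟩
  exact ⟨i, by omega, rfl⟩

/-- The product `e (j + l - 1) * ⋯ * e j` of `l` generators with decreasing indices. -/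
def desc (j : ℕ) : ℕ → A
  | 0 => 1
  | l + 1 => S.e (j + l) * desc j l

/-- The product `e j * ⋯ * e (j + l - 1)` of `l` generators with increasing indices. -/
def asc (j : ℕ) : ℕ → A
  | 0 => 1
  | l + 1 => asc j l * S.e (j + l)

theorem desc_add (j l l' : ℕ) : S.desc j (l + l') = S.desc (j + l) l' * S.desc j l := by
  induction l' with
  | zero => simp [desc]
  | succ l' ih => rw [← add_assoc, desc, ih, desc, mul_assoc, add_assoc]

theorem desc_one (j : ℕ) : S.desc j 1 = S.e j := by simp [desc]

theorem desc_succ' (j l : ℕ) : S.desc j (l + 1) = S.desc (j + 1) l * S.e j := by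
  rw [add_comm, desc_add, desc_one]

theorem asc_succ' (j l : ℕ) : S.asc j (l + 1) = S.e j * S.asc (j + 1) l := by
  induction l with
  | zero => simp [asc]
  | succ l ih => rw [asc, ih, asc, mul_assoc, show j + (l + 1) = j + 1 + l by ring]

theorem desc_mem {j l k : ℕ} (h : j + l ≤ k) : S.desc j l ∈ S.words k := by
  induction l with
  | zero => exact one_mem _
  | succ l ih => exact mul_mem (S.e_mem (by omega)) (ih (by omega))

theorem asc_mem {j l k : ℕ} (h : j + l ≤ k) : S.asc j l ∈ S.words k := by
  induction l with
  | zero => exact one_mem _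
  | succ l ih => exact mul_mem (ih (by omega)) (S.e_mem (by omega))

theorem commute_e {i j : ℕ} (hij : i + 1 < j ∨ j + 1 < i) (hi : i + 1 < n) (hj : j + 1 < n) :
    Commute (S.e i) (S.e j) := by
  rcases hij with h | h
  · exact S.far i j h hj
  · exact (S.far j i h hi).symm

theorem commute_desc {i j l : ℕ} (hij : i + 1 < j ∨ j + l < i) (hi : i + 1 < n)
    (hl : j + l < n) : Commute (S.e i) (S.desc j l) := by
  induction l with
  | zero => exact Commute.one_right _
  | succ l ih => exact (S.commute_e (by omega) hi (by omega)).mul_right (ih (by omega) (by omega))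

theorem desc_commute_desc {i j l m : ℕ} (hij : i + l < j) (hm : j + m < n) :
    Commute (S.desc i l) (S.desc j m) := by
  induction l with
  | zero => exact Commute.one_left _
  | succ l ih => exact (S.commute_desc (by omega) (by omega) hm).mul_left (ih (by omega))

/-- Left multiplication by `e (j + q)` removes `e (j + q + 1)` from a decreasing product. -/
theorem e_mul_desc (j q r : ℕ) (h : j + q + 2 + r ≤ n - 1) :
    S.e (j + q) * S.desc j (q + 2 + r) = S.desc (j + q + 2) r * S.desc j (q + 1) := by
  have h1 : S.desc j (q + 2 + r) =
      S.desc (j + q + 2) r * (S.e (j + q + 1) * (S.e (j + q) * S.desc j q)) := by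
    rw [desc_add, desc, desc]; rfl
  have h2 := (S.commute_desc (i := j + q) (j := j + q + 2) (l := r) (by omega) (by omega)
    (by omega)).eq
  rw [h1, ← mul_assoc, h2, mul_assoc, desc]
  congr 1
  rw [← mul_assoc, ← mul_assoc, S.up _ (by omega)]

/-- Right multiplication by `e (j + q + 2)` removes `e (j + q + 1)` from a decreasing product. -/
theorem desc_mul_e (j q r : ℕ) (h : j + q + 2 + (r + 1) ≤ n - 1) :
    S.desc j (q + 2 + (r + 1)) * S.e (j + q + 2) = S.desc (j + q + 2) (r + 1) * S.desc j (q + 1) := by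
  have h1 : S.desc j (q + 2 + (r + 1)) =
      S.desc (j + q + 3) r * S.e (j + q + 2) * (S.e (j + q + 1) * S.desc j (q + 1)) := by
    rw [desc_add, desc_succ', desc]; rfl
  have h2 := (S.commute_desc (i := j + q + 2) (j := j) (l := q + 1) (by omega) (by omega)
    (by omega)).eq
  have h3 := S.down (j + q + 1) (by omega)
  calc S.desc j (q + 2 + (r + 1)) * S.e (j + q + 2)
      = S.desc (j + q + 3) r * S.e (j + q + 2) *
          (S.e (j + q + 1) * (S.desc j (q + 1) * S.e (j + q + 2))) := by rw [h1]; simp only [mul_assoc]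
    _ = S.desc (j + q + 3) r *
          (S.e (j + q + 2) * S.e (j + q + 1) * S.e (j + q + 2)) * S.desc j (q + 1) := by
        rw [← h2]; simp only [mul_assoc]
    _ = S.desc (j + q + 2) (r + 1) * S.desc j (q + 1) := by rw [h3, desc_succ' _ (j + q + 2)]

theorem desc_mul_asc (j l : ℕ) (h : j + l + 1 < n) :
    S.desc j (l + 1) * S.asc (j + 1) l = S.e (j + l) := by
  induction l with
  | zero => simp [asc, desc_one]
  | succ l ih =>
    rw [desc, asc, mul_assoc, ← mul_assoc (S.desc j (l + 1)), ih (by omega), ← mul_assoc,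
      show j + 1 + l = j + l + 1 by ring]
    exact S.down _ (by omega)

theorem e_mul_asc_mul_desc (j l : ℕ) (h : j + l + 1 < n) :
    S.e j * (S.asc (j + 1) l * S.desc j l) = S.e j := by
  rw [← mul_assoc, ← asc_succ']
  induction l with
  | zero => simp [asc, desc]
  | succ l ih =>
    have h3 := S.up (j + l) (by omega)
    rw [asc, asc, desc, mul_assoc (S.asc j l * S.e (j + l)), ← mul_assoc (S.e (j + (l + 1))),
      ← mul_assoc, mul_assoc (S.asc j l), ← mul_assoc (S.e (j + l)), ← add_assoc, h3]
    rw [asc] at ih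
    exact ih (by omega)

/-- Each word in the first `k + 1` generators is equal to a word in which `e k` occurs at most
once, as the first letter of a decreasing product at the end. -/
theorem words_succ {k : ℕ} (hk : k + 1 < n) {w : A} (hw : w ∈ S.words (k + 1)) :
    w ∈ S.words k ∨ ∃ j l, j + l = k ∧ ∃ s ∈ S.words k, w = s * S.desc j (l + 1) := by
  -- The set of these words is closed under right multiplication by each generator `e i`; the
  -- cases are distinguished by the position of `i` relative to the last index `j` of the word.
  induction hw using Submonoid.closure_induction_right with
  | one => exact Or.inl (one_mem _)
  | mul_right w _ a ha ih =>
    rcases ha with rfl | ⟨i, hi, rfl⟩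
    · rcases ih with h | ⟨j, l, hl, s, hs, rfl⟩
      · exact Or.inl (mul_mem h (S.x_mem k))
      · exact Or.inr ⟨j, l, hl, s * S.x, mul_mem hs (S.x_mem k), by
          rw [mul_assoc, mul_assoc, ← S.x_comm]⟩
    rcases ih with h | ⟨j, l, hl, s, hs, rfl⟩
    · rcases Nat.lt_succ_iff_lt_or_eq.1 hi with hi | rfl
      · exact Or.inl (mul_mem h (S.e_mem hi))
      · exact Or.inr ⟨i, 0, rfl, w, h, by rw [desc_one]⟩
    refine Or.inr ?_
    have : i + 1 < j ∨ i + 1 = j ∨ i = j ∨ i = j + 1 ∨ j + 2 ≤ i := by omega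
    rcases this with h | rfl | rfl | rfl | h
    · refine ⟨j, l, hl, s * S.e i, mul_mem hs (S.e_mem (by omega)), ?_⟩
      rw [mul_assoc, mul_assoc, (S.commute_desc (by omega) (by omega) (by omega)).eq]
    · exact ⟨i, l + 1, by omega, s, hs, by rw [mul_assoc, ← desc_succ']⟩
    · refine ⟨i, l, hl, s * S.x, mul_mem hs (S.x_mem k), ?_⟩
      rw [desc_succ', mul_assoc, mul_assoc, S.sq _ (by omega), mul_assoc, ← mul_assoc _ S.x,
        ← S.x_comm, mul_assoc]
    · obtain ⟨l, rfl⟩ : ∃ l', l = l' + 1 := ⟨l - 1, by omega⟩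
      refine ⟨j + 1, l, by omega, s, hs, ?_⟩
      have h3 := S.down j (by omega)
      rw [mul_assoc] at h3
      simp only [desc_succ', mul_assoc, h3]
    · obtain ⟨q, rfl⟩ : ∃ q, i = j + q + 2 := ⟨i - j - 2, by omega⟩
      obtain ⟨r, hr⟩ : ∃ r, l + 1 = q + 2 + (r + 1) := ⟨l - q - 2, by omega⟩
      refine ⟨j + q + 2, r, by omega, s * S.desc j (q + 1),
        mul_mem hs (S.desc_mem (by omega)), ?_⟩
      rw [hr, mul_assoc, desc_mul_e _ _ _ _ (by omega), mul_assoc,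
        (S.desc_commute_desc (i := j) (j := j + q + 2) (by omega) (by omega)).eq]

/-- A word in the first `k + 1` generators that ends in `e k` can be written with no other
occurrence of `e k`. -/
theorem words_mul_e {k : ℕ} (hk : k + 1 < n) {w : A} (hw : w ∈ S.words (k + 1)) :
    ∃ p ∈ S.words k, w * S.e k = p * S.e k := by
  rcases S.words_succ hk hw with h | ⟨j, l, hl, s, hs, rfl⟩
  · exact ⟨w, h, rfl⟩
  have : k = j ∨ k = j + 1 ∨ j + 2 ≤ k := by omega
  rcases this with rfl | rfl | h
  · obtain rfl : l = 0 := by omega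
    refine ⟨s * S.x, mul_mem hs (S.x_mem k), ?_⟩
    rw [desc_one, mul_assoc, mul_assoc, S.sq _ hk]
  · obtain rfl : l = 1 := by omega
    refine ⟨s, hs, ?_⟩
    rw [desc_succ', desc_one, mul_assoc, S.down _ hk]
  · obtain ⟨q, rfl⟩ : ∃ q, k = j + q + 2 := ⟨k - j - 2, by omega⟩
    obtain rfl : l = q + 2 := by omega
    refine ⟨s * S.desc j (q + 1), mul_mem hs (S.desc_mem (by omega)), ?_⟩
    rw [mul_assoc, show q + 2 + 1 = q + 2 + (0 + 1) from rfl, desc_mul_e _ _ _ _ (by omega),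
      desc_one, mul_assoc, (S.commute_desc (by omega) (by omega) (by omega)).eq]

/-! ### The color matrix determines the word -/

theorem ρ_trivialAt {k : ℕ} {w : A} (hw : w ∈ S.words k) (p : Fin n)
    (hp : k < p) : TrivialAt p (S.ρ w) := by
  induction hw using Submonoid.closure_induction with
  | mem a ha =>
    rcases ha with rfl | ⟨i, hi, rfl⟩
    · rw [S.ρ_x]; exact TrivialAt.two
    · rw [S.ρ_e _ (by omega)]; exact TrivialAt.hatMat (by omega) (by omega)
  | one => rw [map_one]; exact TrivialAt.one
  | mul a b _ _ ha hb => rw [map_mul]; exact ha.mul hb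

theorem ρ_pos {k : ℕ} (hk : k < n) {w : A} (hw : w ∈ S.words k) :
    0 < S.ρ w (fun _ => false) (fun _ => false) := by
  induction hw using Submonoid.closure_induction with
  | mem a ha =>
    rcases ha with rfl | ⟨i, hi, rfl⟩
    · rw [S.ρ_x, ← one_add_one_eq_two, Matrix.add_apply]; simp
    · rw [S.ρ_e _ (by omega)]; exact hatMat_apply_false_pos _ _
  | one => rw [map_one]; simp
  | mul a b _ _ ha hb => rw [map_mul]; exact mul_apply_false_pos ha hb

/-- The matrix of `w` satisfies the equation that expresses the bottom edge `{j', (j + 1)'}`. -/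
def HasCup (w : A) (j : ℕ) : Prop := S.ρ w * hatMat n j = 2 * S.ρ w

theorem hasCup_mul_e {j : ℕ} (hj : j + 1 < n) (w : A) : S.HasCup (w * S.e j) j := by
  rw [HasCup, map_mul, S.ρ_e _ hj, mul_assoc, hatMat_sq hj, ← mul_assoc,
    (Commute.ofNat_right (S.ρ w) 2).eq, mul_assoc]

/-- Two bottom edges with exactly one common vertex are impossible. -/
theorem not_hasCup_hasCup_succ {k j : ℕ} (hk : k < n) (hj : j + 2 < n) {w : A}
    (hw : w ∈ S.words k) (h1 : S.HasCup w j) (h2 : S.HasCup w (j + 1)) : False := by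
  have h3 : S.ρ w * (hatMat n j * hatMat n (j + 1) * hatMat n j) = 2 * (2 * (2 * S.ρ w)) := by
    rw [← mul_assoc, ← mul_assoc, h1, mul_assoc 2, h2, mul_assoc, mul_assoc, h1]
  rw [hatMat_up hj, h1] at h3
  have h4 := congrFun (congrFun h3 (fun _ => false)) (fun _ => false)
  have h5 := S.ρ_pos hk hw
  simp only [two_mul, Matrix.add_apply] at h4
  omega

/-- A word whose diagram has the bottom edge `{j', (j + 1)'}` is equal to a word ending
in `e j`. -/
theorem exists_eq_mul_e {k : ℕ} (hk : k < n) {w : A} (hw : w ∈ S.words k) {j : ℕ} (hj : j < k)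
    (hc : S.HasCup w j) : ∃ w' ∈ S.words k, w = w' * S.e j := by
  induction k generalizing w j with
  | zero => omega
  | succ k ih =>
    rcases S.words_succ hk hw with hwk | ⟨i, l, hl, s, hs, rfl⟩
    · rcases Nat.lt_succ_iff_lt_or_eq.1 hj with hj | rfl
      · obtain ⟨w', hw', h⟩ := ih (by omega) hwk hj hc
        exact ⟨w', S.words_mono (by omega) hw', h⟩
      · exact absurd hc (TrivialAt.not_mul_hatMat hk (S.ρ_trivialAt hwk _ (by simp))
          (S.ρ_pos (by omega) hwk))
    have hsk := S.words_mono (Nat.le_succ k) hs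
    have hi : S.HasCup (s * S.desc i (l + 1)) i := by
      rw [desc_succ', ← mul_assoc]; exact S.hasCup_mul_e (by omega) _
    -- A generator that can be moved from the right of the decreasing product to its left shows
    -- that `s` has a cup: right multiplication by an increasing product reduces the decreasing
    -- one to `e k`, which can be cancelled since `s` does not involve `e k`.
    have transfer : ∀ t, t < k → S.ρ (s * S.e t * S.desc i (l + 1)) =
        2 * S.ρ (s * S.desc i (l + 1)) → S.HasCup s t := by
      intro t ht h
      have h1 := congrArg (· * S.ρ (S.asc (i + 1) l)) h
      simp only [mul_assoc, ← map_mul, S.desc_mul_asc i l (by omega), hl] at h1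
      simp only [map_mul, S.ρ_e t (by omega), S.ρ_e k hk] at h1
      refine TrivialAt.mul_hatMat_cancel hk ?_ ?_ (by simpa only [mul_assoc] using h1)
      · exact (S.ρ_trivialAt hs _ (by simp)).mul
          (TrivialAt.hatMat (by simp; omega) (by simp; omega))
      · exact TrivialAt.two.mul (S.ρ_trivialAt hs _ (by simp))
    have : j + 1 < i ∨ i = j + 1 ∨ j = i ∨ j = i + 1 ∨ i + 2 ≤ j := by omega
    rcases this with h | rfl | rfl | rfl | h
    · have hcomm := (S.commute_desc (i := j) (j := i) (l := l + 1) (by omega) (by omega)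
        (by omega)).eq
      have hsj : S.HasCup s j := transfer j (by omega) (by
        rw [mul_assoc, hcomm, ← mul_assoc, map_mul, S.ρ_e _ (by omega), hc])
      obtain ⟨s', hs', rfl⟩ := ih (by omega) hs (by omega) hsj
      refine ⟨s' * S.desc i (l + 1), mul_mem (S.words_mono (Nat.le_succ k) hs') (S.desc_mem (by omega)), ?_⟩
      rw [mul_assoc, hcomm, mul_assoc]
    · exact (S.not_hasCup_hasCup_succ hk (by omega) hw hc hi).elim
    · exact ⟨s * S.desc (j + 1) l, mul_mem hsk (S.desc_mem (by omega)), by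
        rw [mul_assoc, ← desc_succ']⟩
    · exact (S.not_hasCup_hasCup_succ hk (by omega) hw hi hc).elim
    · obtain ⟨q, rfl⟩ : ∃ q, j = i + q + 2 := ⟨j - i - 2, by omega⟩
      obtain ⟨r, hr⟩ : ∃ r, l + 1 = q + 2 + (r + 1) := ⟨l - q - 2, by omega⟩
      have hshift : S.e (i + q) * S.desc i (l + 1) = S.desc i (l + 1) * S.e (i + q + 2) := by
        rw [hr, e_mul_desc _ _ _ _ (by omega), desc_mul_e _ _ _ _ (by omega)]
      have hsj : S.HasCup s (i + q) := transfer (i + q) (by omega) (by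
        rw [mul_assoc, hshift, ← mul_assoc, map_mul, S.ρ_e _ (by omega), hc])
      obtain ⟨s', hs', rfl⟩ := ih (by omega) hs (by omega) hsj
      refine ⟨s' * S.desc i (l + 1), mul_mem (S.words_mono (Nat.le_succ k) hs') (S.desc_mem (by omega)), ?_⟩
      rw [mul_assoc, hshift, mul_assoc]

theorem two_pow_apply_false (n a : ℕ) :
    ((2 : ColorMat n) ^ a) (fun _ => false) (fun _ => false) = 2 ^ a := by
  induction a with
  | zero => simp
  | succ a ih => rw [pow_succ', two_mul, Matrix.add_apply, ih, pow_succ']; ring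

/-- Words with the same color matrix are equal. Here `x` has the matrix `2`, so that the matrix of
a word counts its loops. -/
theorem ρ_injOn {k : ℕ} (hk : k < n) {u v : A} (hu : u ∈ S.words k) (hv : v ∈ S.words k)
    (h : S.ρ u = S.ρ v) : u = v := by
  induction k generalizing u v with
  | zero =>
    have h0 : ∀ w ∈ S.words 0, ∃ a : ℕ, w = S.x ^ a := by
      intro w hw
      have : S.words 0 = Submonoid.powers S.x := by
        rw [words, Submonoid.powers_eq_closure]; simp
      rw [this] at hw
      obtain ⟨a, rfl⟩ := hw
      exact ⟨a, rfl⟩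
    obtain ⟨a, rfl⟩ := h0 u hu
    obtain ⟨b, rfl⟩ := h0 v hv
    rw [map_pow, map_pow, S.ρ_x] at h
    have h1 := congrFun (congrFun h (fun _ => false)) (fun _ => false)
    rw [two_pow_apply_false, two_pow_apply_false] at h1
    rw [Nat.pow_right_injective le_rfl h1]
  | succ k ih =>
    have key : ∀ u v : A, v ∈ S.words (k + 1) → S.ρ u = S.ρ v → ∀ j l, j + l = k →
        ∀ s ∈ S.words k, u = s * S.desc j (l + 1) → u = v := by
      rintro u v hv h j l hl s hs rfl
      -- Both words end in `e j`, so right multiplication by `asc (j + 1) l` loses nothing, and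
      -- it turns the decreasing product into `e k`.
      have hjc : S.HasCup v j := by
        rw [HasCup, ← h, desc_succ', ← mul_assoc]; exact S.hasCup_mul_e (by omega) _
      obtain ⟨v', -, rfl⟩ := S.exists_eq_mul_e hk hv (by omega) hjc
      have huv : S.ρ (s * S.e k) = S.ρ (v' * S.e j * S.asc (j + 1) l) := by
        rw [map_mul (S.ρ) (v' * S.e j), ← h, ← map_mul, mul_assoc, S.desc_mul_asc j l (by omega), hl]
      have hv1 : v' * S.e j * S.asc (j + 1) l ∈ S.words (k + 1) :=
        mul_mem hv (S.asc_mem (by omega))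
      have hkc : S.HasCup (v' * S.e j * S.asc (j + 1) l) k := by
        rw [HasCup, ← huv]; exact S.hasCup_mul_e hk _
      obtain ⟨v'', hv'', h2⟩ := S.exists_eq_mul_e hk hv1 (Nat.lt_succ_self k) hkc
      obtain ⟨p, hp, h3⟩ := S.words_mul_e hk hv''
      have hsp : S.ρ s = S.ρ p := by
        rw [h2, h3, map_mul, map_mul, S.ρ_e k hk] at huv
        exact TrivialAt.mul_hatMat_cancel hk (S.ρ_trivialAt hs _ (by simp))
          (S.ρ_trivialAt hp _ (by simp)) huv
      have hsv : s * S.e k = v' * S.e j * S.asc (j + 1) l := by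
        rw [h2, h3, ih (by omega) hs hp hsp]
      calc s * S.desc j (l + 1) = s * S.e k * S.desc j l := by rw [desc, hl, mul_assoc]
        _ = v' * (S.e j * (S.asc (j + 1) l * S.desc j l)) := by rw [hsv]; simp only [mul_assoc]
        _ = v' * S.e j := by rw [S.e_mul_asc_mul_desc j l (by omega)]
    rcases S.words_succ hk hu with hu' | ⟨j, l, hl, s, hs, h'⟩
    · rcases S.words_succ hk hv with hv' | ⟨j, l, hl, s, hs, h'⟩
      · exact ih (by omega) hu' hv' h
      · exact (key v u hu h.symm j l hl s hs h').symm
    · exact key u v hv h j l hl s hs h'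

end TLSystem

end TemperleyLieb

/-! ### Every diagram is a product of the diagrams `ê_i` -/

namespace TemperleyLieb

namespace Diagram

variable {n : ℕ}

theorem boundaryPos_inl (i : Fin n) : boundaryPos (Sum.inl i : Vertex n) = i := rfl

theorem boundaryPos_inr (i : Fin n) : boundaryPos (Sum.inr i : Vertex n) = 2 * n - 1 - i := rfl

/-- If some edge joins two vertices of the bottom line, then some edge joins two neighbors on it:
an innermost one does. -/
theorem exists_adj_succ (d : Diagram n) {i k : Fin n} (hik : i < k)
    (h : d.graph.Adj (Sum.inr i) (Sum.inr k)) :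
    ∃ (j : ℕ) (hj : j + 1 < n), d.graph.Adj (Sum.inr ⟨j, by omega⟩) (Sum.inr ⟨j + 1, hj⟩) := by
  induction hm : (k : ℕ) - i using Nat.strong_induction_on generalizing i k with
  | _ m ih =>
    have hik' : (i : ℕ) < k := hik
    by_cases h1 : (i : ℕ) + 1 = k
    · exact ⟨i, by omega, by convert h⟩
    -- By planarity the edge at `(i + 1)'` is enclosed by the edge `{i', k'}`, hence shorter.
    have hl : (i : ℕ) + 1 < n := by omega
    have hadj := d.adj_partner (Sum.inr ⟨i + 1, hl⟩)
    have n1 := d.noncrossing _ _ _ _ h.symm hadj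
    have n2 := d.noncrossing _ _ _ _ hadj.symm h.symm
    have hne1 : d.partner (Sum.inr ⟨i + 1, hl⟩) ≠ Sum.inr i := by
      intro he
      rw [he] at hadj
      have := (d.adj_iff _ _).1 hadj.symm
      rw [← (d.adj_iff _ _).1 h, Sum.inr.injEq, Fin.ext_iff] at this
      exact h1 this
    have hne2 : d.partner (Sum.inr ⟨i + 1, hl⟩) ≠ Sum.inr k := by
      intro he
      rw [he] at hadj
      have := (d.adj_iff _ _).1 hadj.symm
      rw [← (d.adj_iff _ _).1 h.symm, Sum.inr.injEq, Fin.ext_iff] at this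
      simp at this
    have hne3 := d.partner_ne (Sum.inr ⟨i + 1, hl⟩)
    rcases hp : d.partner (Sum.inr ⟨i + 1, hl⟩) with t | t <;>
      rw [hp] at hadj n1 n2 hne1 hne2 hne3 <;>
      simp only [boundaryPos_inl, boundaryPos_inr, ne_eq, Sum.inr.injEq, Fin.ext_iff] at *
    · omega
    · exact ih (t - (i + 1)) (by omega) (i := ⟨i + 1, hl⟩) (k := t)
        (by rw [Fin.lt_def]; simp only; omega) hadj rfl

/-- A diagram without an edge between vertices of the bottom line is the identity. -/
theorem eq_id_of_forall (d : Diagram n)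
    (h : ∀ i k : Fin n, ¬ d.graph.Adj (Sum.inr i) (Sum.inr k)) : d = id n := by
  have h1 : ∀ i : Fin n, ∃ k : Fin n, d.graph.Adj (Sum.inr i) (Sum.inl k) := by
    intro i
    rcases hp : d.partner (Sum.inr i) with k | k
    · exact ⟨k, (d.adj_iff _ _).2 hp.symm⟩
    · exact absurd ((d.adj_iff _ _).2 hp.symm) (h i k)
  choose g hg using h1
  have hmono : StrictMono g := by
    intro i k hik
    have hne : g i ≠ g k := by
      intro he
      have h2 := (d.adj_iff _ _).1 (hg i).symm
      rw [he, ← (d.adj_iff _ _).1 (hg k).symm, Sum.inr.injEq] at h2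
      exact hik.ne h2
    have n1 := d.noncrossing _ _ _ _ (hg k).symm (hg i).symm
    simp only [boundaryPos_inl, boundaryPos_inr] at n1
    rw [Fin.lt_def] at hik ⊢
    rw [ne_eq, Fin.ext_iff] at hne
    omega
  have hgi : ∀ i, g i = i := fun i =>
    congrFun ((hmono.range_inj strictMono_id).1
      (by rw [Set.range_id, (Finite.injective_iff_surjective.1 hmono.injective).range_eq])) i
  have hadj : ∀ i : Fin n, d.graph.Adj (Sum.inl i) (Sum.inr i) := fun i => by
    simpa only [hgi] using (hg i).symm
  have hpl : ∀ i, Sum.inr i = d.partner (Sum.inl i) := fun i => (d.adj_iff _ _).1 (hadj i)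
  have hpr : ∀ i, Sum.inl i = d.partner (Sum.inr i) := fun i => (d.adj_iff _ _).1 (hadj i).symm
  ext v w
  rw [d.adj_iff]
  rcases v with v | v <;> rcases w with w | w <;> simp [← hpl, ← hpr, id]

/-! #### Removing a cup at the right end -/

/-- The number of a vertex on its line. -/
def col : Vertex n → ℕ
  | Sum.inl i => i
  | Sum.inr i => i

/-- The relabeling that replaces the vertex `m'` by `m + 1`. -/
def lift (m : ℕ) (hm : m + 1 < n) (v : Vertex n) : Vertex n :=
  if v = Sum.inr ⟨m, by omega⟩ then Sum.inl ⟨m + 1, hm⟩ else v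

theorem col_inl (i : Fin n) : col (Sum.inl i : Vertex n) = i := rfl

theorem col_inr (i : Fin n) : col (Sum.inr i : Vertex n) = i := rfl

theorem lift_inl (m : ℕ) (hm : m + 1 < n) (i : Fin n) :
    lift m hm (Sum.inl i) = Sum.inl i := by simp [lift]

theorem lift_inr_self (m : ℕ) (hm : m + 1 < n) :
    lift m hm (Sum.inr ⟨m, by omega⟩) = Sum.inl ⟨m + 1, hm⟩ := by simp [lift]

theorem lift_inr_of_ne (m : ℕ) (hm : m + 1 < n) {i : Fin n} (h : (i : ℕ) ≠ m) :
    lift m hm (Sum.inr i) = Sum.inr i := by simp [lift, Fin.ext_iff, h]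

/-- `lift` preserves the order of the boundary on the vertices with number at most `m`. -/
theorem lift_lt {m : ℕ} (hm : m + 1 < n) {v w : Vertex n} (hv : col v ≤ m) (hw : col w ≤ m)
    (h : boundaryPos v < boundaryPos w) :
    boundaryPos (lift m hm v) < boundaryPos (lift m hm w) := by
  rcases v with v | v <;> rcases w with w | w <;>
    simp only [lift, reduceCtorEq, if_false, Sum.inr.injEq, Fin.ext_iff] <;>
    (try split_ifs) <;>
    simp only [boundaryPos_inl, boundaryPos_inr, col_inl, col_inr] at * <;> omega

/-- `d` is straight from the vertices numbered `k` on, that is, contains the edges `{j, j'}` for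
`j ≥ k`. -/
def StraightFrom (k : ℕ) (d : Diagram n) : Prop :=
  ∀ j : Fin n, k ≤ j → d.graph.Adj (Sum.inl j) (Sum.inr j)

/-- In a diagram with the bottom edge `{m', (m + 1)'}` that is straight thereafter, the images under
`lift` of the vertices with number at most `m` are matched among themselves. -/
theorem exists_lift_adj {m : ℕ} (hm : m + 1 < n) {d : Diagram n} (hd : d.StraightFrom (m + 2))
    (hc : d.graph.Adj (Sum.inr ⟨m, by omega⟩) (Sum.inr ⟨m + 1, hm⟩)) (v : Vertex n)
    (hv : col v ≤ m) : ∃ w, col w ≤ m ∧ d.graph.Adj (lift m hm v) (lift m hm w) := by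
  have hlift : ∀ u : Vertex n, u ≠ Sum.inr ⟨m, by omega⟩ → u ≠ Sum.inr ⟨m + 1, hm⟩ →
      col u < m + 2 → ∃ w, col w ≤ m ∧ lift m hm w = u := by
    rintro (u | u) h1 h2 h3
    · by_cases hu : (u : ℕ) = m + 1
      · exact ⟨Sum.inr ⟨m, by omega⟩, le_rfl, by
          rw [lift_inr_self]; exact congrArg Sum.inl (Fin.ext hu.symm)⟩
      · exact ⟨Sum.inl u, by rw [col_inl] at *; omega, lift_inl _ _ _⟩
    · simp only [ne_eq, Sum.inr.injEq, Fin.ext_iff] at h1 h2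
      exact ⟨Sum.inr u, by rw [col_inr] at *; omega, lift_inr_of_ne _ _ h1⟩
  have hv1 : lift m hm v ≠ Sum.inr ⟨m, by omega⟩ ∧ lift m hm v ≠ Sum.inr ⟨m + 1, hm⟩ ∧
      col (lift m hm v) < m + 2 := by
    rcases v with v | v
    · rw [lift_inl]; exact ⟨by simp, by simp, by omega⟩
    · by_cases h : (v : ℕ) = m
      · rw [show v = ⟨m, by omega⟩ from Fin.ext h, lift_inr_self]; exact ⟨by simp, by simp, by simp [col]⟩
      · rw [lift_inr_of_ne _ _ h]
        rw [col_inr] at hv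
        simp only [ne_eq, Sum.inr.injEq, Fin.ext_iff, col_inr]
        omega
  suffices h : ∃ w, col w ≤ m ∧ lift m hm w = d.partner (lift m hm v) by
    obtain ⟨w, hw, hw'⟩ := h
    exact ⟨w, hw, by rw [hw']; exact d.adj_partner _⟩
  refine hlift _ ?_ ?_ ?_
  · intro h
    apply hv1.2.1
    rw [← d.partner_partner (lift m hm v), h, ← (d.adj_iff _ _).1 hc]
  · intro h
    apply hv1.1
    rw [← d.partner_partner (lift m hm v), h, ← (d.adj_iff _ _).1 hc.symm]
  · by_contra h
    have h1 : col (d.partner (d.partner (lift m hm v))) = col (d.partner (lift m hm v)) := by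
      rcases hp : d.partner (lift m hm v) with t | t <;> rw [hp] at h
      · rw [← (d.adj_iff _ _).1 (hd t (by rw [col_inl] at h; omega))]; rfl
      · rw [← (d.adj_iff _ _).1 (hd t (by rw [col_inr] at h; omega)).symm]; rfl
    rw [d.partner_partner] at h1
    omega

theorem lift_injOn {m : ℕ} (hm : m + 1 < n) {v w : Vertex n} (hv : col v ≤ m) (hw : col w ≤ m)
    (h : lift m hm v = lift m hm w) : v = w := by
  by_contra hne
  rcases Nat.lt_or_gt_of_ne (fun he => hne (boundaryPos_injective he)) with h1 | h1
  · exact (lift_lt hm hv hw h1).ne (congrArg _ h)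
  · exact (lift_lt hm hw hv h1).ne' (congrArg _ h)

/-- Let `d` be a diagram with the bottom edge `{m', (m + 1)'}` and straight thereafter. Attach
the edge at the top vertex `m + 1` to the bottom vertex `m'` instead, and make the vertex `m + 1`
straight. The product of the resulting diagram with `ê_m` is `d`. -/
def unCup {m : ℕ} (hm : m + 1 < n) (d : Diagram n) (hd : d.StraightFrom (m + 2))
    (hc : d.graph.Adj (Sum.inr ⟨m, by omega⟩) (Sum.inr ⟨m + 1, hm⟩)) : Diagram n where
  graph :=
    { Adj := fun v w => (col v ≤ m ∧ col w ≤ m ∧ d.graph.Adj (lift m hm v) (lift m hm w)) ∨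
        (m < col v ∧ col w = col v ∧ v ≠ w)
      symm := ⟨by
        rintro v w (⟨h1, h2, h3⟩ | ⟨h1, h2, h3⟩)
        · exact Or.inl ⟨h2, h1, h3.symm⟩
        · exact Or.inr ⟨by omega, h2.symm, h3.symm⟩⟩
      loopless := ⟨by
        rintro v (⟨-, -, h⟩ | ⟨-, -, h⟩)
        · exact d.graph.loopless.irrefl _ h
        · exact h rfl⟩ }
  existsUnique_adj := by
    intro v
    by_cases hv : col v ≤ m
    · obtain ⟨w, hw, h⟩ := exists_lift_adj hm hd hc v hv
      refine ⟨w, Or.inl ⟨hv, hw, h⟩, ?_⟩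
      rintro u (⟨-, hu, h'⟩ | ⟨h', -, -⟩)
      · exact lift_injOn hm hu hw (((d.adj_iff _ _).1 h').trans ((d.adj_iff _ _).1 h).symm)
      · omega
    · rcases v with v | v
      · refine ⟨Sum.inr v, Or.inr ⟨by omega, rfl, by simp⟩, ?_⟩
        rintro (w | w) (⟨h, -, -⟩ | ⟨-, h, h'⟩)
        · omega
        · exact absurd (congrArg Sum.inl (Fin.ext h.symm)) h'
        · omega
        · exact congrArg Sum.inr (Fin.ext h)
      · refine ⟨Sum.inl v, Or.inr ⟨by omega, rfl, by simp⟩, ?_⟩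
        rintro (w | w) (⟨h, -, -⟩ | ⟨-, h, h'⟩)
        · omega
        · exact congrArg Sum.inl (Fin.ext h)
        · omega
        · exact absurd (congrArg Sum.inr (Fin.ext h.symm)) h'
  noncrossing := by
    rintro a b c e (⟨ha, hb, hab⟩ | ⟨ha, hb, hab⟩) (⟨hc, he, hce⟩ | ⟨hc, he, hce⟩) ⟨h1, h2, h3⟩
    · exact d.noncrossing _ _ _ _ hab hce
        ⟨lift_lt hm ha hc h1, lift_lt hm hc hb h2, lift_lt hm hb he h3⟩
    all_goals
      rcases a with a | a <;> rcases b with b | b <;> rcases c with c | c <;>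
        rcases e with e | e <;>
        simp only [boundaryPos_inl, boundaryPos_inr, col_inl, col_inr, ne_eq, Sum.inl.injEq,
          Sum.inr.injEq, Fin.ext_iff, reduceCtorEq, not_false_eq_true] at * <;> omega

theorem straightFrom_unCup {m : ℕ} (hm : m + 1 < n) (d : Diagram n)
    (hd : d.StraightFrom (m + 2))
    (hc : d.graph.Adj (Sum.inr ⟨m, by omega⟩) (Sum.inr ⟨m + 1, hm⟩)) :
    (unCup hm d hd hc).StraightFrom (m + 1) :=
  fun _ hj => Or.inr ⟨hj, rfl, by simp⟩

theorem colorMatrix_unCup {m : ℕ} (hm : m + 1 < n) (d : Diagram n)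
    (hd : d.StraightFrom (m + 2))
    (hc : d.graph.Adj (Sum.inr ⟨m, by omega⟩) (Sum.inr ⟨m + 1, hm⟩)) :
    colorMatrix (unCup hm d hd hc) * hatMat n m = colorMatrix d := by
  classical
  ext a b
  rw [mul_hatMat_apply hm]
  by_cases hb : b ⟨m, by omega⟩ = b ⟨m + 1, hm⟩
  swap
  · rw [if_neg hb, eq_comm, colorMatrix_eq_zero_iff]
    exact fun h => hb (h _ _ hc)
  have hlift : ∀ v : Vertex n, col v ≤ m →
      Sum.elim a (setPair b m (a ⟨m + 1, hm⟩)) v = Sum.elim a b (lift m hm v) := by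
    rintro (v | v) hv
    · rw [lift_inl]; rfl
    · by_cases h : (v : ℕ) = m
      · rw [show v = ⟨m, by omega⟩ from Fin.ext h, lift_inr_self]; simp [setPair]
      · rw [lift_inr_of_ne _ _ h]
        rw [col_inr] at hv
        simp only [Sum.elim_inr, setPair]
        exact if_neg (by omega)
  have hzero : colorMatrix (unCup hm d hd hc) a (setPair b m (!a ⟨m + 1, hm⟩)) = 0 := by
    rw [colorMatrix_eq_zero_iff]
    intro h
    have := h _ _ (straightFrom_unCup hm d hd hc ⟨m + 1, hm⟩ le_rfl)
    simp [setPair] at this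
  have hval : colorMatrix (unCup hm d hd hc) a (setPair b m (a ⟨m + 1, hm⟩)) =
      colorMatrix d a b := by
    refine colorMatrix_congr ⟨fun h => ?_, fun h => ?_⟩
    · have hstraight : ∀ j : Fin n, m + 2 ≤ j → a j = b j := by
        intro j hj
        have := h _ _ (straightFrom_unCup hm d hd hc j (by omega))
        simp only [Sum.elim_inl, Sum.elim_inr, setPair] at this
        rwa [if_neg (by omega)] at this
      -- Every vertex is straight, on the cup, or the image of a vertex under `lift`.
      have hvertex : ∀ v : Vertex n,
          (∃ j : Fin n, m + 2 ≤ j ∧ (v = Sum.inl j ∨ v = Sum.inr j)) ∨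
            v = Sum.inr ⟨m, by omega⟩ ∨ v = Sum.inr ⟨m + 1, hm⟩ ∨
            ∃ u, col u ≤ m ∧ lift m hm u = v := by
        rintro (v | v)
        · by_cases h1 : m + 2 ≤ (v : ℕ)
          · exact Or.inl ⟨v, h1, Or.inl rfl⟩
          · refine Or.inr (Or.inr (Or.inr ?_))
            by_cases h2 : (v : ℕ) = m + 1
            · exact ⟨Sum.inr ⟨m, by omega⟩, le_rfl, by
                rw [lift_inr_self]; exact congrArg Sum.inl (Fin.ext h2.symm)⟩
            · exact ⟨Sum.inl v, by rw [col_inl]; omega, lift_inl _ _ _⟩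
        · by_cases h1 : m + 2 ≤ (v : ℕ)
          · exact Or.inl ⟨v, h1, Or.inr rfl⟩
          · refine Or.inr ?_
            by_cases h2 : (v : ℕ) = m
            · exact Or.inl (congrArg Sum.inr (Fin.ext h2))
            by_cases h3 : (v : ℕ) = m + 1
            · exact Or.inr (Or.inl (congrArg Sum.inr (Fin.ext h3)))
            · exact Or.inr (Or.inr ⟨Sum.inr v, by rw [col_inr]; omega, lift_inr_of_ne _ _ h2⟩)
      intro v w hvw
      rcases hvertex v with ⟨j, hj, rfl | rfl⟩ | rfl | rfl | ⟨u, hu, rfl⟩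
      · rw [(d.adj_iff _ _).1 hvw, ← (d.adj_iff _ _).1 (hd j hj)]
        exact hstraight j hj
      · rw [(d.adj_iff _ _).1 hvw, ← (d.adj_iff _ _).1 (hd j hj).symm]
        exact (hstraight j hj).symm
      · rw [(d.adj_iff _ _).1 hvw, ← (d.adj_iff _ _).1 hc]
        exact hb
      · rw [(d.adj_iff _ _).1 hvw, ← (d.adj_iff _ _).1 hc.symm]
        exact hb.symm
      · obtain ⟨u', hu', h'⟩ := exists_lift_adj hm hd hc u hu
        have hw : w = lift m hm u' := ((d.adj_iff _ _).1 hvw).trans ((d.adj_iff _ _).1 h').symm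
        rw [hw, ← hlift u hu, ← hlift u' hu']
        exact h u u' (Or.inl ⟨hu, hu', h'⟩)
    · have key : ∀ j : Fin n, m < j → a j = setPair b m (a ⟨m + 1, hm⟩) j := by
        intro j hj
        by_cases h1 : (j : ℕ) = m + 1
        · obtain rfl : j = ⟨m + 1, hm⟩ := Fin.ext h1
          simp [setPair]
        · simp only [setPair]
          rw [if_neg (by omega)]
          exact h _ _ (hd j (by omega))
      rintro v w (⟨hv, hw, hvw⟩ | ⟨hv, hw, hvw⟩)
      · rw [hlift v hv, hlift w hw]
        exact h _ _ hvw
      · rcases v with v | v <;> rcases w with w | w <;> simp only [col_inl, col_inr] at hv hw <;>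
          obtain rfl := Fin.ext hw
        · exact absurd rfl hvw
        · exact key _ hv
        · exact (key _ hv).symm
        · exact absurd rfl hvw
  rw [if_pos hb]
  cases ha : a ⟨m + 1, hm⟩ <;> rw [ha] at hzero hval
  · rw [hval, show setPair b m true = setPair b m (!false) from rfl, hzero, zero_add]
  · rw [hval, show setPair b m false = setPair b m (!true) from rfl, hzero, add_zero]

/-! #### Moving a cup to the right -/

theorem colorMatrix_mul_hatMat_iff {m : ℕ} (hm : m + 1 < n) (d : Diagram n) :
    colorMatrix d * hatMat n m = 2 * colorMatrix d ↔
      d.graph.Adj (Sum.inr ⟨m, by omega⟩) (Sum.inr ⟨m + 1, hm⟩) := by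
  constructor
  · intro h
    refine d.adj_of_forall_compatible (by simp) fun o ho => ?_
    by_contra hne
    have h1 := congrFun (congrFun h (fun i => o (Sum.inl i))) (fun i => o (Sum.inr i))
    rw [mul_hatMat_apply hm, if_neg hne, two_mul, Matrix.add_apply, eq_comm, add_eq_zero,
      colorMatrix_eq_zero_iff, show Sum.elim (fun i => o (Sum.inl i)) (fun i => o (Sum.inr i)) = o
      from Sum.elim_comp_inl_inr o] at h1
    exact h1.1 ho
  · intro h
    ext a b
    rw [mul_hatMat_apply hm, two_mul, Matrix.add_apply]
    split_ifs with hb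
    · have key : ∀ b b' : Fin n → Bool, b' ⟨m, by omega⟩ = b' ⟨m + 1, hm⟩ →
          (∀ t : Fin n, (t : ℕ) ≠ m → (t : ℕ) ≠ m + 1 → b' t = b t) →
          Compatible d.graph (Sum.elim a b) → Compatible d.graph (Sum.elim a b') := by
        intro b b' hb' hbb' hab
        refine hab.recolor h hb' ?_
        rintro (u | u) h1 h2
        · rfl
        · simp only [ne_eq, Sum.inr.injEq, Fin.ext_iff] at h1 h2
          exact hbb' u h1 h2
      have hset : ∀ v, colorMatrix d a (setPair b m v) = colorMatrix d a b := by
        intro v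
        have h3 : ∀ t : Fin n, (t : ℕ) ≠ m → (t : ℕ) ≠ m + 1 → setPair b m v t = b t :=
          fun t h1 h2 => if_neg (by omega)
        exact colorMatrix_congr ⟨key _ _ hb fun t h1 h2 => (h3 t h1 h2).symm,
          key _ _ (by simp [setPair]) h3⟩
      rw [hset, hset]
    · have : colorMatrix d a b = 0 := by
        rw [colorMatrix_eq_zero_iff]
        exact fun hc => hb (hc _ _ h)
      rw [this]

/-- The product with `ê_{j+1}` moves a cup from `j` to `j + 1` without producing loops, and the
product with `ê_j` moves it back. -/
theorem exists_move_cup {j : ℕ} (hj : j + 2 < n) (d : Diagram n)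
    (hc : d.graph.Adj (Sum.inr ⟨j, by omega⟩) (Sum.inr ⟨j + 1, by omega⟩)) :
    ∃ d' : Diagram n, colorMatrix d' = colorMatrix d * hatMat n (j + 1) ∧
      colorMatrix d = colorMatrix d' * hatMat n j := by
  have hcup := (colorMatrix_mul_hatMat_iff (by omega) d).2 hc
  have hback : colorMatrix d * hatMat n (j + 1) * hatMat n j = colorMatrix d := by
    have h1 : 2 * (colorMatrix d * hatMat n (j + 1) * hatMat n j) = 2 * colorMatrix d := by
      rw [← mul_assoc, ← mul_assoc, ← hcup, mul_assoc, mul_assoc, ← mul_assoc (hatMat n j),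
        hatMat_up hj]
    ext a b
    have h2 := congrFun (congrFun h1 a) b
    simp only [two_mul, Matrix.add_apply] at h2
    omega
  -- A loop would contribute a factor `2` to the matrix on the left of `hback`.
  set e₁ : Diagram n := hatE ⟨j + 1, by omega⟩ with he₁
  set e₀ : Diagram n := hatE ⟨j, by omega⟩ with he₀
  have hloops : loops d e₁ = 0 := by
    have h1 := hback
    rw [hatMat_of_lt (by omega), hatMat_of_lt (by omega), ← he₁, ← he₀, colorMatrix_mul,
      Matrix.smul_mul, colorMatrix_mul, smul_smul, ← pow_add] at h1
    have h2 := (colorMatrix_injective (q := 0) (h1.trans (by rw [pow_zero, one_smul]))).1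
    omega
  refine ⟨comp d e₁, ?_, ?_⟩
  · rw [hatMat_of_lt (by omega), ← he₁, colorMatrix_mul, hloops, pow_zero, one_smul]
  · nth_rw 1 [← hback]
    rw [hatMat_of_lt (m := j + 1) (by omega), ← he₁, colorMatrix_mul, hloops, pow_zero, one_smul]

/-- The color matrix of a diagram is a product of the matrices of the `ê_i`: move a cup to the
right end of the part that is not straight, and remove it there by `unCup`. -/
theorem exists_list_colorMatrix (d : Diagram n) :
    ∃ l : List (Fin (n - 1)), colorMatrix d = (l.map fun i : Fin (n - 1) => hatMat n i).prod := by
  suffices H : ∀ k ≤ n, ∀ d : Diagram n, d.StraightFrom k → ∃ l : List (Fin (n - 1)),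
      colorMatrix d = (l.map fun i : Fin (n - 1) => hatMat n i).prod from
    H n le_rfl d fun j hj => absurd j.2 (by omega)
  intro k
  induction k with
  | zero =>
    refine fun _ d hd => ⟨[], ?_⟩
    have : d = id n := d.eq_id_of_forall fun i k h => by
      have h1 := (d.adj_iff _ _).1 h
      rw [← (d.adj_iff _ _).1 (hd i (Nat.zero_le _)).symm] at h1
      cases h1
    rw [this, colorMatrix_id]; rfl
  | succ k ih =>
    intro hk d hd
    by_cases hid : ∀ i k : Fin n, ¬ d.graph.Adj (Sum.inr i) (Sum.inr k)
    · exact ⟨[], by rw [d.eq_id_of_forall hid, colorMatrix_id]; rfl⟩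
    push Not at hid
    obtain ⟨i₁, i₂, h12⟩ := hid
    have hcup : ∃ (j : ℕ) (hj : j + 1 < n),
        d.graph.Adj (Sum.inr ⟨j, by omega⟩) (Sum.inr ⟨j + 1, hj⟩) := by
      rcases lt_trichotomy i₁ i₂ with h | rfl | h
      · exact d.exists_adj_succ h h12
      · exact absurd h12 (d.graph.loopless.irrefl _)
      · exact d.exists_adj_succ h h12.symm
    obtain ⟨j, hj, hc⟩ := hcup
    clear h12
    induction hm : k - j generalizing j d with
    | zero =>
      -- The vertex `j + 1` would be straight.
      have hjk : j + 1 < k + 1 := by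
        by_contra hjk
        have h1 := (d.adj_iff _ _).1 hc.symm
        rw [← (d.adj_iff _ _).1 (hd ⟨j + 1, hj⟩ (by simp only; omega)).symm] at h1
        cases h1
      omega
    | succ r ihr =>
      by_cases hr : r = 0
      · obtain rfl : k = j + 1 := by omega
        obtain ⟨l, hl⟩ := ih (by omega) (unCup hj d hd hc) (straightFrom_unCup hj d hd hc)
        refine ⟨l ++ [⟨j, by omega⟩], ?_⟩
        rw [← colorMatrix_unCup hj d hd hc, hl]
        simp
      · obtain ⟨d', h1, h2⟩ := exists_move_cup (by omega) d hc
        obtain ⟨l, hl⟩ := ihr d' (fun p hp => TrivialAt.adj (by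
          rw [h1]
          exact (TrivialAt.colorMatrix (hd p hp)).mul
            (TrivialAt.hatMat (by omega) (by omega)))) (j + 1) (by omega)
          ((colorMatrix_mul_hatMat_iff (by omega) d').1 (by
            rw [h1, mul_assoc, hatMat_sq (by omega), ← mul_assoc,
              (Commute.ofNat_right (colorMatrix d) 2).eq, mul_assoc])) (by omega)
        refine ⟨l ++ [⟨j, by omega⟩], ?_⟩
        rw [h2, hl]
        simp

end Diagram

end TemperleyLieb

/-! ### The isomorphism with the diagram algebra -/

namespace TemperleyLieb

variable {k : Type*} [CommRing k] {n : ℕ}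

namespace DiagramAlgebra

/-- Products of the `ê_i` in the diagram algebra and products of their color matrices record the
same data, a diagram and a number of loops. -/
theorem exists_prod_hatE_eq (δ : k) (l : List (Fin (n - 1))) : ∃ (a : ℕ) (d : Diagram n),
    (l.map fun i : Fin (n - 1) => hatMat n i).prod = 2 ^ a • Diagram.colorMatrix d ∧
      (l.map (hatE δ)).prod = single δ d (δ ^ a) := by
  induction l using List.reverseRecOn with
  | nil => exact ⟨0, Diagram.id n, by simp [Diagram.colorMatrix_id], by rw [pow_zero]; rfl⟩
  | append_singleton l i ih =>
    obtain ⟨a, d, h1, h2⟩ := ih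
    refine ⟨a + d.loops (Diagram.hatE i), d.comp (Diagram.hatE i), ?_, ?_⟩
    · rw [List.map_append, List.prod_append, h1, List.map_singleton, List.prod_singleton,
        hatMat_of_lt i.2, Matrix.smul_mul, Diagram.colorMatrix_mul, smul_smul, ← pow_add]
    · rw [List.map_append, List.prod_append, h2, List.map_singleton, List.prod_singleton, hatE,
        ofDiagram, single_mul_single, mul_one, ← pow_add]

/-- An equality of products of color matrices, up to a power of `2`, gives the corresponding
equality in the diagram algebra, up to the same power of `δ`. -/
theorem prod_hatE_eq_smul (δ : k) (l l' : List (Fin (n - 1))) (a : ℕ)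
    (h : (l.map fun i : Fin (n - 1) => hatMat n i).prod =
      2 ^ a • (l'.map fun i : Fin (n - 1) => hatMat n i).prod) :
    (l.map (hatE δ)).prod = δ ^ a • (l'.map (hatE δ)).prod := by
  obtain ⟨b, d, h1, h2⟩ := exists_prod_hatE_eq δ l
  obtain ⟨b', d', h1', h2'⟩ := exists_prod_hatE_eq δ l'
  rw [h1, h1', smul_smul, ← pow_add] at h
  obtain ⟨rfl, rfl⟩ := Diagram.colorMatrix_injective h
  rw [h2, h2', smul_single, pow_add]

theorem exists_list_ofDiagram (δ : k) (d : Diagram n) :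
    ∃ l : List (Fin (n - 1)), ofDiagram δ d = (l.map (hatE δ)).prod := by
  obtain ⟨l, hl⟩ := d.exists_list_colorMatrix
  obtain ⟨a, d', h1, h2⟩ := exists_prod_hatE_eq δ l
  obtain ⟨rfl, rfl⟩ := Diagram.colorMatrix_injective (p := 0)
    ((one_smul _ _).trans (hl.trans h1))
  exact ⟨l, by rw [h2, pow_zero]; rfl⟩

theorem hatE_rel (δ : k) {a b : FreeAlgebra k (Fin (n - 1))} (h : Rel n δ a b) :
    FreeAlgebra.lift k (hatE δ) a = FreeAlgebra.lift k (hatE δ) b := by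
  cases h with
  | sq i =>
    have h1 := prod_hatE_eq_smul δ [i, i] [i] 1 (by
      simp [hatMat_sq (n := n) (i := i) (by omega), two_smul, two_mul])
    simpa using h1
  | braid i j h =>
    have h1 := prod_hatE_eq_smul δ [i, j, i] [i] 0 (by
      have hij : (j : ℕ) = i + 1 ∨ (i : ℕ) = j + 1 := by
        rcases (abs_eq zero_le_one).1 h with h | h <;> omega
      rcases hij with hij | hij
      · simpa [hij, mul_assoc] using hatMat_up (n := n) (i := i) (by omega)
      · simpa [hij, mul_assoc] using hatMat_down (n := n) (i := j) (by omega))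
    simpa [mul_assoc] using h1
  | comm i j h =>
    have h1 := prod_hatE_eq_smul δ [i, j] [j, i] 0 (by
      have hij : (i : ℕ) + 1 < j ∨ (j : ℕ) + 1 < i := by
        rcases lt_abs.1 h with h | h <;> omega
      rcases hij with hij | hij
      · simpa using hatMat_far hij (n := n) (by omega)
      · simpa using (hatMat_far hij (n := n) (by omega)).symm)
    simpa using h1

end DiagramAlgebra

namespace TL

/-- The morphism `TL_n(δ) → D_n(δ)` that maps `e_i` to `ê_i`. -/
noncomputable def toDiagram (n : ℕ) (δ : k) : TL n δ →ₐ[k] DiagramAlgebra n δ :=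
  RingQuot.liftAlgHom k ⟨FreeAlgebra.lift k (DiagramAlgebra.hatE δ),
    fun _ _ h => DiagramAlgebra.hatE_rel δ h⟩

theorem toDiagram_e (δ : k) (i : Fin (n - 1)) :
    toDiagram n δ (e δ i) = DiagramAlgebra.hatE δ i := by
  rw [toDiagram, e, RingQuot.liftAlgHom_mkAlgHom_apply, FreeAlgebra.lift_ι_apply]

theorem e_sq (δ : k) (i : Fin (n - 1)) : e δ i * e δ i = algebraMap k _ δ * e δ i := by
  rw [← Algebra.smul_def, e, ← map_mul, ← map_smul]
  exact RingQuot.mkAlgHom_rel k (Rel.sq i)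

theorem e_braid (δ : k) {i j : Fin (n - 1)} (h : |((i : ℕ) : ℤ) - ((j : ℕ) : ℤ)| = 1) :
    e δ i * e δ j * e δ i = e δ i := by
  simp only [e, ← map_mul]
  exact RingQuot.mkAlgHom_rel k (Rel.braid i j h)

theorem e_comm (δ : k) {i j : Fin (n - 1)} (h : 1 < |((i : ℕ) : ℤ) - ((j : ℕ) : ℤ)|) :
    e δ i * e δ j = e δ j * e δ i := by
  simp only [e, ← map_mul]
  exact RingQuot.mkAlgHom_rel k (Rel.comm i j h)

/-- The generators of `TL_n(δ)` paired with their color matrices. In the submonoid they generate,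
together with `(δ, 2)`, the elements of `TL_n(δ)` are determined by their matrices. -/
noncomputable def system (n : ℕ) (δ : k) : TLSystem n (TL n δ × ColorMat n) where
  e i := if h : i < n - 1 then (e δ ⟨i, h⟩, hatMat n i) else 1
  x := (algebraMap k _ δ, 2)
  x_comm a := Prod.ext (Algebra.commutes _ _) (Commute.ofNat_left 2 a.2).eq
  sq i h := by
    rw [dif_pos (by omega)]
    exact Prod.ext (e_sq δ _) (hatMat_sq h)
  up i h := by
    rw [dif_pos (by omega), dif_pos (by omega)]
    exact Prod.ext (e_braid δ (by simp)) (hatMat_up h)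
  down i h := by
    rw [dif_pos (by omega), dif_pos (by omega)]
    exact Prod.ext (e_braid δ (by simp)) (hatMat_down h)
  far i j hij h := by
    rw [dif_pos (by omega), dif_pos (by omega)]
    refine Prod.ext (e_comm δ ?_) (hatMat_far hij h)
    exact lt_abs.2 (Or.inr (by simp only; omega))
  ρ := MonoidHom.snd _ _
  ρ_x := rfl
  ρ_e i h := by rw [dif_pos (by omega)]; rfl

theorem system_e (δ : k) (i : Fin (n - 1)) :
    (system n δ).e i = (e δ i, hatMat n i) := dif_pos i.2

/-- Each diagram has a lift to `TL_n(δ)` that is a word in the generators. -/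
theorem exists_lift (δ : k) (d : Diagram n) :
    ∃ t : TL n δ, (t, Diagram.colorMatrix d) ∈ (system n δ).words (n - 1) := by
  obtain ⟨l, hl⟩ := d.exists_list_colorMatrix
  refine ⟨(l.map (e δ)).prod, ?_⟩
  have h : ((l.map (e δ)).prod, Diagram.colorMatrix d) =
      (l.map fun i : Fin (n - 1) => (system n δ).e i).prod := by
    rw [hl]
    clear hl
    induction l with
    | nil => rfl
    | cons i l ih =>
      rw [List.map_cons, List.prod_cons, List.map_cons, List.prod_cons, List.map_cons,
        List.prod_cons, ← ih, system_e, Prod.mk_mul_mk]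
  rw [h]
  refine Submonoid.list_prod_mem _ fun a ha => ?_
  obtain ⟨i, -, rfl⟩ := List.mem_map.1 ha
  exact (system n δ).e_mem i.2

/-- The lift of a diagram to `TL_n(δ)`. -/
noncomputable def liftDiagram (δ : k) (d : Diagram n) : TL n δ := (exists_lift δ d).choose

theorem liftDiagram_mem (δ : k) (d : Diagram n) :
    (liftDiagram δ d, Diagram.colorMatrix d) ∈ (system n δ).words (n - 1) :=
  (exists_lift δ d).choose_spec

theorem liftDiagram_id (hn : 0 < n) (δ : k) : liftDiagram δ (Diagram.id n) = 1 := by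
  have h := (system n δ).ρ_injOn (by omega) (liftDiagram_mem δ (Diagram.id n)) (one_mem _)
    (Diagram.colorMatrix_id n)
  exact congrArg Prod.fst h

/-- Both sides are words with the same color matrix. -/
theorem liftDiagram_mul_e (hn : 0 < n) (δ : k) (d : Diagram n) (i : Fin (n - 1)) :
    liftDiagram δ d * e δ i =
      δ ^ d.loops (Diagram.hatE i) • liftDiagram δ (d.comp (Diagram.hatE i)) := by
  have h := (system n δ).ρ_injOn (by omega)
    (mul_mem (liftDiagram_mem δ d) ((system n δ).e_mem i.2))
    (mul_mem (pow_mem ((system n δ).x_mem (n - 1)) (d.loops (Diagram.hatE i)))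
      (liftDiagram_mem δ (d.comp (Diagram.hatE i)))) (by
        rw [system_e, Prod.mk_mul_mk, hatMat_of_lt i.2]
        refine (Diagram.colorMatrix_mul d (Diagram.hatE i)).trans ?_
        rw [nsmul_eq_mul]
        simp [system])
  rw [system_e] at h
  refine (congrArg Prod.fst h).trans ?_
  rw [Algebra.smul_def, map_pow]
  rfl

/-- The linear extension of the lifting of diagrams. -/
noncomputable def ofDiagram (n : ℕ) (δ : k) : DiagramAlgebra n δ →ₗ[k] TL n δ :=
  Finsupp.linearCombination k (liftDiagram δ)

theorem ofDiagram_single (δ : k) (d : Diagram n) (r : k) :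
    ofDiagram n δ (DiagramAlgebra.single δ d r) = r • liftDiagram δ d :=
  Finsupp.linearCombination_single k r d

theorem ofDiagram_mul_hatE (hn : 0 < n) (δ : k) (a : DiagramAlgebra n δ) (i : Fin (n - 1)) :
    ofDiagram n δ (a * DiagramAlgebra.hatE δ i) = ofDiagram n δ a * e δ i := by
  induction a using DiagramAlgebra.induction with
  | zero => rw [zero_mul, map_zero, zero_mul]
  | add a b ha hb => rw [add_mul, map_add, ha, hb, map_add, add_mul]
  | single d r =>
    rw [DiagramAlgebra.hatE, DiagramAlgebra.ofDiagram, DiagramAlgebra.single_mul_single,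
      ofDiagram_single, ofDiagram_single, smul_mul_assoc, liftDiagram_mul_e hn, mul_one, mul_smul]

/-- `TL.ofDiagram` is a morphism of right modules over `TL_n(δ)`, hence a left inverse of
`TL.toDiagram` as soon as it maps `1` to `1`. -/
theorem ofDiagram_mul_toDiagram (hn : 0 < n) (δ : k) (a : DiagramAlgebra n δ) (b : TL n δ) :
    ofDiagram n δ (a * toDiagram n δ b) = ofDiagram n δ a * b := by
  obtain ⟨b, rfl⟩ := RingQuot.mkAlgHom_surjective k (Rel n δ) b
  induction b using FreeAlgebra.induction generalizing a with
  | grade0 r =>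
    rw [AlgHom.commutes, AlgHom.commutes, ← Algebra.commutes, ← Algebra.smul_def, map_smul,
      ← Algebra.commutes, ← Algebra.smul_def]
  | grade1 i =>
    exact (congrArg _ (congrArg _ (toDiagram_e δ i))).trans (ofDiagram_mul_hatE hn δ a i)
  | mul b c hb hc => rw [map_mul (RingQuot.mkAlgHom k (Rel n δ)), map_mul (toDiagram n δ), ← mul_assoc, hc, hb, mul_assoc]
  | add b c hb hc => rw [map_add, map_add, mul_add, map_add, hb, hc, mul_add]

theorem toDiagram_bijective (hn : 0 < n) (δ : k) : Function.Bijective (toDiagram n δ) := by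
  constructor
  · refine Function.LeftInverse.injective (g := ofDiagram n δ) fun b => ?_
    have h1 : ofDiagram n δ 1 = 1 :=
      (ofDiagram_single δ (Diagram.id n) 1).trans (by rw [one_smul, liftDiagram_id hn])
    have h2 := ofDiagram_mul_toDiagram hn δ 1 b
    rwa [one_mul, h1, one_mul] at h2
  · intro a
    induction a using DiagramAlgebra.induction with
    | zero => exact ⟨0, map_zero _⟩
    | add a b ha hb =>
      obtain ⟨a, rfl⟩ := ha
      obtain ⟨b, rfl⟩ := hb
      exact ⟨a + b, map_add _ _ _⟩
    | single d r =>
      obtain ⟨l, hl⟩ := DiagramAlgebra.exists_list_ofDiagram δ d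
      refine ⟨r • (l.map (e δ)).prod, ?_⟩
      rw [map_smul, map_list_prod, List.map_map,
        show ⇑(toDiagram n δ) ∘ e δ = DiagramAlgebra.hatE δ from funext (toDiagram_e δ), ← hl,
        DiagramAlgebra.ofDiagram, DiagramAlgebra.smul_single, mul_one]

end TL

end TemperleyLieb

open TemperleyLieb Polynomial in
theorem theorem2p2 (n : ℕ) (hn : 0 < n) :
    (∀ (k : Type*) [CommRing k] (δ : k) (d : Diagram n), ∃ l : List (Fin (n - 1)),
      DiagramAlgebra.ofDiagram δ d = (l.map (DiagramAlgebra.hatE δ)).prod) ∧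
    ∃ σ : TL n (X : ℤ[X]) ≃ₐ[ℤ[X]] DiagramAlgebra n (X : ℤ[X]),
      ∀ i : Fin (n - 1), σ (TL.e X i) = DiagramAlgebra.hatE X i :=
  ⟨fun _ _ δ d => DiagramAlgebra.exists_list_ofDiagram δ d,
    AlgEquiv.ofBijective (TL.toDiagram n X) (TL.toDiagram_bijective hn X), TL.toDiagram_e X⟩
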